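/- Let $-\infty<\delta_1<\delta_2<\infty$, let $\mathcal Y\subset(\delta_1,\delta_2)$ be a set of $m\ge 1$ distinct points $y_{(1)}<\dots<y_{(m)}$, and put $y_{(0)}=\delta_1$, $y_{(m+1)}=\delta_2$, $I_i=(y_{(i-1)},y_{(i)})$ for $1\le i\le m+1$. Let $\tau\in(0,\infty)$ and $c\in(0,1)$. The central similarity proximity region $N(x)=N(x,\tau,c)$ is defined as follows. For $x\in I_1$ it is $\bigl(x-\tau(y_{(1)}-x),\,x+\tau(y_{(1)}-x)\bigr)$ if $\tau<1$ and $\bigl(x-\tau(y_{(1)}-x),\,y_{(1)}\bigr)$ if $\tau\ge1$. For $x\in I_{m+1}$ it is $\bigl(x-\tau(x-y_{(m)}),\,x+\tau(x-y_{(m)})\bigr)$ if $\tau<1$ and $\bigl(y_{(m)},\,x+\tau(x-y_{(m)})\bigr)$ if $\tau\ge1$. For $x$ in a middle interval $I_i=(a,b)$, $2\le i\le m$, it is $\bigl(x-\tau(x-a),\,x+\tau(1-c)(x-a)/c\bigr)\cap(a,b)$ if $x<a+c(b-a)$ and $\bigl(x-c\tau(b-x)/(1-c),\,x+\tau(b-x)\bigr)\cap(a,b)$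 otherwise; and $N(x)=\{x\}$ for $x\in\mathcal Y$. Let $X_1,X_2,\dots$ be independent and uniformly distributed on $(\delta_1,\delta_2)$. For $n\ge 1$, consider the digraph with vertices $X_1,\dots,X_n$ and an arc from $X_a$ to $X_b$ ($a\ne b$) whenever $X_b\in N(X_a)$; let $D_{[i]}(\tau,c)$ be its subdigraph induced by the $n_i$ vertices that lie in $I_i$, and let $\rho_{[i]}(\tau,c)$ be the relative density of $D_{[i]}(\tau,c)$, that is, its number of arcs divided by $n_i(n_i-1)$ (and $0$ if $n_i\le1$). Let $i\in\{1,m+1\}$, so that $I_i$ is an end interval. For $U_1,U_2,U_3$ independent and uniform on $I_i$, let $\mu_e(\tau)=P(U_2\in N(U_1))$ be the arc probability, and let $\nu_e(\tau)=\operatorname{Cov}(h_{12},h_{13})$, where $h_{jk}=\tfrac12\bigl(\mathbf 1\{U_k\in N(U_j)\}+\mathbf 1\{U_j\in N(U_k)\}\bigr)$. Then $$\mu_e(\tau)=\begin{cases}\dfrac{\tau(\tau+2)}{2(\tau+1)},&0<\tau<1,\\[2mm]\dfrac{1+2\tau}{2(\tau+1)},&\tau\ge1,\end{cases}\qquad 4\nu_e(\tau)=\begin{cases}\dfrac{\tau^2(4\tau+4-2\tau^4-4\tau^3-\tau^2)}{3(\tau+1)^3},&0<\tau<1,\\[2mm]\dfrac{\tau^2}{3(\tau+1)^3},&\tau\ge1,\end{cases}$$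 with $\nu_e(\tau)>0$, and $$\sqrt{n_i}\,\bigl[\rho_{[i]}(\tau,c)-\mu_e(\tau)\bigr]\longrightarrow\mathcal N\bigl(0,4\nu_e(\tau)\bigr)\quad\text{in law as } n_i\to\infty.$$ The convergence holds in both of the following senses: conditionally on the value of $n_i$, as this value tends to infinity (for all integers $0\le k_j\le N_j$ with $k_j\to\infty$ as $j\to\infty$, the conditional law of the left-hand side for sample size $n=N_j$, given the event $n_i=k_j$, which has positive probability, converges weakly to $\mathcal N(0,4\nu_e(\tau))$); and unconditionally, with random $n_i$, as the sample size $n\to\infty$. -/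

import Mathlib

open MeasureTheory ProbabilityTheory Filter Topology

noncomputable section

namespace CentralSimilarity

/-- The points `y_(0), y_(1), ..., y_(m), y_(m+1)`, where `y_(1) < ... < y_(m)` are the elements of
`Y` in increasing order, `y_(0) = δ₁` and `y_(m+1) = δ₂`. -/
def orderStat (δ₁ δ₂ : ℝ) (Y : Finset ℝ) (i : ℕ) : ℝ :=
  if i = 0 then δ₁
  else if h : i - 1 < Y.card then Y.orderEmbOfFin rfl ⟨i - 1, h⟩
  else δ₂

/-- The `i`-th interval `(y_(i-1), y_(i))`, for `i = 1, ..., m + 1`. -/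
def cell (δ₁ δ₂ : ℝ) (Y : Finset ℝ) (i : ℕ) : Set ℝ :=
  Set.Ioo (orderStat δ₁ δ₂ Y (i - 1)) (orderStat δ₁ δ₂ Y i)

/-- Central similarity proximity region of `x` in a middle interval `(a, b)` with center
`a + c (b - a)`. At the center itself, the second of the two allowed choices is taken. -/
def middleRegion (a b τ c x : ℝ) : Set ℝ :=
  (if x < a + c * (b - a) then
      Set.Ioo (x - τ * (x - a)) (x + τ * (1 - c) * (x - a) / c)
    else
      Set.Ioo (x - c * τ * (b - x) / (1 - c)) (x + τ * (b - x))) ∩ Set.Ioo a b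

/-- Central similarity proximity region of a point `x < y` of the left end interval, where `y` is
the smallest point of `Y`: it is `(x - τ (y - x), x + τ (y - x))` if `τ < 1` and
`(x - τ (y - x), y)` if `τ ≥ 1`. -/
def leftEndRegion (y τ x : ℝ) : Set ℝ :=
  if τ < 1 then Set.Ioo (x - τ * (y - x)) (x + τ * (y - x))
  else Set.Ioo (x - τ * (y - x)) y

/-- Central similarity proximity region of a point `x > y` of the right end interval, where `y` is
the largest point of `Y`: it is `(x - τ (x - y), x + τ (x - y))` if `τ < 1` and
`(y, x + τ (x - y))` if `τ ≥ 1`. -/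
def rightEndRegion (y τ x : ℝ) : Set ℝ :=
  if τ < 1 then Set.Ioo (x - τ * (x - y)) (x + τ * (x - y))
  else Set.Ioo y (x + τ * (x - y))

/-- The number `i` of the interval `(y_(i-1), y_(i))` that a point `x ∉ Y` belongs to. -/
def cellIndex (Y : Finset ℝ) (x : ℝ) : ℕ := (Y.filter (fun y => y < x)).card + 1

/-- The central similarity proximity map with expansion parameter `τ` and centrality parameter
`c`, with respect to the points of `Y`. -/
def proximityRegion (δ₁ δ₂ : ℝ) (Y : Finset ℝ) (τ c x : ℝ) : Set ℝ :=
  if x ∈ Y then {x}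
  else if cellIndex Y x = 1 then leftEndRegion (orderStat δ₁ δ₂ Y 1) τ x
  else if cellIndex Y x = Y.card + 1 then rightEndRegion (orderStat δ₁ δ₂ Y Y.card) τ x
  else middleRegion (orderStat δ₁ δ₂ Y (cellIndex Y x - 1)) (orderStat δ₁ δ₂ Y (cellIndex Y x)) τ c x

/-- Relative density of a digraph of order `n`: the number of its arcs (between distinct vertices)
divided by `n (n - 1)`; it is `0` for `n ≤ 1`. -/
def relativeDensity {V : Type*} (D : Digraph V) : ℝ :=
  (Nat.card {p : V × V // p.1 ≠ p.2 ∧ D.Adj p.1 p.2} : ℝ) /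
    ((Nat.card V : ℝ) * ((Nat.card V : ℝ) - 1))

/-- The proximity catch digraph of a proximity map `N` and data points `x`: there is an arc from
`a` to `b` if and only if `x b ∈ N (x a)`. -/
def catchDigraph {V : Type*} (N : ℝ → Set ℝ) (x : V → ℝ) : Digraph V where
  Adj a b := x b ∈ N (x a)

/-- The vertices of the subdigraph on the `i`-th interval: (the indices of) those of the data
points `x 0, ..., x (n - 1)` that lie in that interval. -/
def cellVertices (δ₁ δ₂ : ℝ) (Y : Finset ℝ) (i n : ℕ) (x : ℕ → ℝ) : Set (Fin n) :=
  {a | x a ∈ cell δ₁ δ₂ Y i}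

/-- The number `n_i` of data points, among `x 0, ..., x (n - 1)`, in the `i`-th interval. -/
def cellCount (δ₁ δ₂ : ℝ) (Y : Finset ℝ) (i n : ℕ) (x : ℕ → ℝ) : ℕ :=
  Nat.card (cellVertices δ₁ δ₂ Y i n x)

/-- The subdigraph `D_[i](τ, c)`, induced by the data points in the `i`-th interval, of the central
similarity proximity catch digraph with vertices `x 0, ..., x (n - 1)`. -/
def cellDigraph (δ₁ δ₂ : ℝ) (Y : Finset ℝ) (τ c : ℝ) (i n : ℕ) (x : ℕ → ℝ) :
    Digraph (cellVertices δ₁ δ₂ Y i n x) where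
  Adj a b := (catchDigraph (proximityRegion δ₁ δ₂ Y τ c) (fun k : Fin n => x k)).Adj a b

/-- The relative density `ρ_[i](τ, c)` of `D_[i](τ, c)`. -/
def cellDensity (δ₁ δ₂ : ℝ) (Y : Finset ℝ) (τ c : ℝ) (i n : ℕ) (x : ℕ → ℝ) : ℝ :=
  relativeDensity (cellDigraph δ₁ δ₂ Y τ c i n x)

/-- The uniform distribution on the `i`-th interval. -/
def cellUniform (δ₁ δ₂ : ℝ) (Y : Finset ℝ) (i : ℕ) : Measure ℝ :=
  cond volume (cell δ₁ δ₂ Y i)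

/-- The arc probability `P(U₂ ∈ N(U₁))` for independent `U₁, U₂` that are uniform on the `i`-th
interval. -/
def arcProb (δ₁ δ₂ : ℝ) (Y : Finset ℝ) (τ c : ℝ) (i : ℕ) : ℝ :=
  ((cellUniform δ₁ δ₂ Y i).prod (cellUniform δ₁ δ₂ Y i)).real
    {p | p.2 ∈ proximityRegion δ₁ δ₂ Y τ c p.1}

/-- The symmetric kernel `h(s, t) = (1{t ∈ N(s)} + 1{s ∈ N(t)}) / 2`. -/
def arcKernel (N : ℝ → Set ℝ) (s t : ℝ) : ℝ :=
  ((N s).indicator 1 t + (N t).indicator 1 s) / 2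

/-- The covariance `Cov(h(U₁, U₂), h(U₁, U₃))` for independent `U₁, U₂, U₃` that are uniform on the
`i`-th interval. -/
def arcCov (δ₁ δ₂ : ℝ) (Y : Finset ℝ) (τ c : ℝ) (i : ℕ) : ℝ :=
  cov[fun u : ℝ × ℝ × ℝ => arcKernel (proximityRegion δ₁ δ₂ Y τ c) u.1 u.2.1,
    fun u : ℝ × ℝ × ℝ => arcKernel (proximityRegion δ₁ δ₂ Y τ c) u.1 u.2.2;
    (cellUniform δ₁ δ₂ Y i).prod ((cellUniform δ₁ δ₂ Y i).prod (cellUniform δ₁ δ₂ Y i))]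

/-- The asymptotic mean `μ_e(τ)` in an end interval. -/
def endMean (τ : ℝ) : ℝ :=
  if τ < 1 then τ * (τ + 2) / (2 * (τ + 1)) else (1 + 2 * τ) / (2 * (τ + 1))

/-- The asymptotic variance `4 ν_e(τ)` in an end interval. -/
def endVariance (τ : ℝ) : ℝ :=
  if τ < 1 then
    τ ^ 2 * (4 * τ + 4 - 2 * τ ^ 4 - 4 * τ ^ 3 - τ ^ 2) / (3 * (τ + 1) ^ 3)
  else τ ^ 2 / (3 * (τ + 1) ^ 3)

/-- The normalized relative density `√n_i (ρ_[i](τ, c) - μ_e(τ))` of the subdigraph on the `i`-th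
interval, based on `x 0, ..., x (n - 1)`. -/
def normalizedDensity (δ₁ δ₂ : ℝ) (Y : Finset ℝ) (τ c : ℝ) (i n : ℕ) (x : ℕ → ℝ) : ℝ :=
  √(cellCount δ₁ δ₂ Y i n x : ℝ) * (cellDensity δ₁ δ₂ Y τ c i n x - endMean τ)

end CentralSimilarity

end

namespace CentralSimilarity

/-! Measure the position of a point of an end interval by its distance to the adjacent point of `Y`,
in units of the interval length. This affine coordinate turns the uniform law on the interval into
the uniform law on `(0, 1)`, and at both ends and for all `τ > 0` an arc `u → v` exists iff `(1 - τ)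
u < v < (1 + τ) u` (`IsUnitCoordinate`, `exists_unitCoordinate`); for `τ ≥ 1` the lower bound is
void.

Summed over ordered pairs, the arc indicator may be symmetrized, so the relative density of `k`
uniform points is a `U`-statistic of order two with a bounded kernel `h`. With `f x = E h(x, U)` and
mean `μ`, the Hoeffding remainder `h(x, y) - f x - f y + μ` has zero mean in each variable, so its
pair terms are mostly orthogonal and their normalized sum vanishes in probability. What is left is a
sum of independent variables `2 f(X_j)`, to which the classical central limit theorem applies
(`tendstoInDistribution_uStatistic`). The limit variance is `Var (2 f) = 4 Cov(h₁₂, h₁₃)`, because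
`h₁₂` and `h₁₃` are independent with common mean `f(U₁)` given `U₁`
(`covariance_common_coordinate`). On `(0, 1)` the function `2 f = outProb + inProb` is piecewise
linear, so both moments are elementary integrals.

For a random number of points, split according to which indices fall in the interval: given these,
the points there are independent and uniform, so the law given `n_i = k` is `unitLaw τ k` whatever
the sample size (`map_restrict_card_pointsIn`). The conditional limit follows at once. The
unconditional one follows by averaging over `n_i`, which tends to infinity almost surely, with
dominated convergence. -/

lemma sum_offDiag_eq {ι : Type*} [DecidableEq ι] (s : Finset ι) (F : ι → ι → ℝ) :
    ∑ p ∈ s.offDiag, F p.1 p.2 = ∑ a ∈ s, ∑ b ∈ s, F a b - ∑ a ∈ s, F a a := by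
  have h := Finset.sum_union (f := fun p : ι × ι => F p.1 p.2) (Finset.disjoint_diag_offDiag s)
  rw [Finset.diag_union_offDiag, Finset.sum_diag, Finset.sum_product] at h
  linarith

/-! ### Central limit theorem for `U`-statistics of order two -/

section UStatistic

variable {Ω S : Type*} [MeasurableSpace Ω] [MeasurableSpace S] {P : Measure Ω}
  [IsProbabilityMeasure P] {Q : Measure S} [IsProbabilityMeasure Q] {X : ℕ → Ω → S}

/-- A degenerate kernel evaluated at `X a, X b` is orthogonal to functions of the other variables. -/
lemma integral_degenerate_mul_eq_zero (hX : ∀ j, Measurable (X j)) (hlaw : ∀ j, P.map (X j) = Q)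
    (hind : iIndepFun X P) {g : S → S → ℝ} (hg : Measurable (Function.uncurry g)) {D : ℝ}
    (hD : ∀ x y, |g x y| ≤ D) (hdeg : ∀ x, ∫ y, g x y ∂Q = 0) {a b c d : ℕ}
    (hba : b ≠ a) (hbc : b ≠ c) (hbd : b ≠ d) :
    ∫ ω, g (X a ω) (X b ω) * g (X c ω) (X d ω) ∂P = 0 := by
  -- The indices `a`, `c`, `d` may coincide. Only the independence of `X b` from the triple matters:
  -- integrating over `X b` first annihilates the first factor.
  have hi := hind.indepFun_finset ({a, c, d} : Finset ℕ) {b} (by simp [hba, hbc, hbd]) hX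
  have hi2 : IndepFun (fun ω => ((X a ω, X c ω), X d ω)) (X b) P :=
    hi.comp (φ := fun z : (({a, c, d} : Finset ℕ) → S) =>
        ((z ⟨a, by simp⟩, z ⟨c, by simp⟩), z ⟨d, by simp⟩))
      (ψ := fun z : (({b} : Finset ℕ) → S) => z ⟨b, by simp⟩) (by fun_prop) (by fun_prop)
  have hZ : Measurable fun ω => ((X a ω, X c ω), X d ω) := by fun_prop
  have hmap := (indepFun_iff_map_prod_eq_prod_map_map hZ.aemeasurable (hX b).aemeasurable).1 hi2
  have : IsProbabilityMeasure (P.map fun ω => ((X a ω, X c ω), X d ω)) :=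
    Measure.isProbabilityMeasure_map hZ.aemeasurable
  let F : ((S × S) × S) × S → ℝ := fun z => g z.1.1.1 z.2 * g z.1.1.2 z.1.2
  have hF : Measurable F :=
    (hg.comp (f := fun z : ((S × S) × S) × S => (z.1.1.1, z.2)) (by fun_prop)).mul
      (hg.comp (f := fun z : ((S × S) × S) × S => (z.1.1.2, z.1.2)) (by fun_prop))
  calc ∫ ω, g (X a ω) (X b ω) * g (X c ω) (X d ω) ∂P
      = ∫ ω, F (((X a ω, X c ω), X d ω), X b ω) ∂P := rfl
    _ = ∫ z, F z ∂(P.map fun ω => (((X a ω, X c ω), X d ω), X b ω)) :=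
        (integral_map (hZ.prodMk (hX b)).aemeasurable hF.aestronglyMeasurable).symm
    _ = 0 := by
        rw [hmap, hlaw b, integral_prod]
        · simp [F, integral_mul_const, hdeg]
        · refine Integrable.of_bound hF.aestronglyMeasurable (D * D) (ae_of_all _ fun z => ?_)
          simp only [F, norm_mul, Real.norm_eq_abs]
          exact mul_le_mul (hD _ _) (hD _ _) (abs_nonneg _) ((abs_nonneg _).trans (hD z.1.1.1 z.2))

/-- Second moment bound for a degenerate `U`-statistic of order two. -/
lemma integral_sq_sum_degenerate_le (hX : ∀ j, Measurable (X j)) (hlaw : ∀ j, P.map (X j) = Q)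
    (hind : iIndepFun X P) {g : S → S → ℝ} (hg : Measurable (Function.uncurry g)) {D : ℝ}
    (hD : ∀ x y, |g x y| ≤ D) (hsymm : ∀ x y, g x y = g y x) (hdeg : ∀ x, ∫ y, g x y ∂Q = 0)
    (n : ℕ) :
    ∫ ω, (∑ p ∈ (Finset.range n).offDiag, g (X p.1 ω) (X p.2 ω)) ^ 2 ∂P
      ≤ 2 * (n * (n - 1)) * (D * D) := by
  have hmeas : ∀ a b, Measurable fun ω => g (X a ω) (X b ω) := fun a b =>
    hg.comp (f := fun ω => (X a ω, X b ω)) ((hX a).prodMk (hX b))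
  have hDD : ∀ x y z w, |g x y * g z w| ≤ D * D := fun x y z w => by
    rw [abs_mul]
    exact mul_le_mul (hD _ _) (hD _ _) (abs_nonneg _) ((abs_nonneg _).trans (hD x y))
  have hint : ∀ p q : ℕ × ℕ,
      Integrable (fun ω => g (X p.1 ω) (X p.2 ω) * g (X q.1 ω) (X q.2 ω)) P := fun p q =>
    Integrable.of_bound ((hmeas _ _).mul (hmeas _ _)).aestronglyMeasurable (D * D)
      (ae_of_all _ fun ω => hDD _ _ _ _)
  -- Unless `q` is `p` or its swap, some index of `p` does not occur in `q`, and integrating it out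
  -- gives zero. Each `p` thus contributes at most `2 D²`.
  have hbound : ∀ p ∈ (Finset.range n).offDiag, ∀ q ∈ (Finset.range n).offDiag,
      ∫ ω, g (X p.1 ω) (X p.2 ω) * g (X q.1 ω) (X q.2 ω) ∂P
        ≤ (if q = p then D * D else 0) + (if q = p.swap then D * D else 0) := by
    rintro ⟨a, b⟩ hp ⟨c, d⟩ hq
    simp only [Finset.mem_offDiag] at hp hq
    have hnn : 0 ≤ D * D := mul_self_nonneg D
    by_cases h : (c = a ∧ d = b) ∨ (c = b ∧ d = a)
    · have h1 : ∫ ω, g (X a ω) (X b ω) * g (X c ω) (X d ω) ∂P ≤ D * D := by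
        calc _ ≤ ∫ ω, D * D ∂P := integral_mono (hint (a, b) (c, d)) (integrable_const _)
              fun ω => (le_abs_self _).trans (hDD _ _ _ _)
          _ = D * D := by simp
      refine h1.trans ?_
      rcases h with ⟨rfl, rfl⟩ | ⟨rfl, rfl⟩
      · rw [if_pos rfl]; split_ifs <;> linarith
      · rw [if_pos (c := (c, d) = Prod.swap (d, c)) rfl]; split_ifs <;> linarith
    · have h0 : ∫ ω, g (X a ω) (X b ω) * g (X c ω) (X d ω) ∂P = 0 := by
        by_cases hb : b = c ∨ b = d
        · simp_rw [fun ω => hsymm (X a ω) (X b ω)]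
          apply integral_degenerate_mul_eq_zero hX hlaw hind hg hD hdeg <;> grind
        · apply integral_degenerate_mul_eq_zero hX hlaw hind hg hD hdeg <;> grind
      rw [h0]
      split_ifs <;> linarith
  simp_rw [sq, Finset.sum_mul_sum]
  rw [integral_finsetSum _ fun p _ => integrable_finsetSum _ fun q _ => hint p q]
  simp_rw [integral_finsetSum _ fun q _ => hint _ q]
  refine (Finset.sum_le_sum fun p hp => Finset.sum_le_sum fun q hq => hbound p hp q hq).trans ?_
  have hcard : ((Finset.range n).offDiag.card : ℝ) = n * (n - 1) := by
    rw [Finset.offDiag_card, Finset.card_range, Nat.cast_sub (Nat.le_mul_self n)]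
    push_cast; ring
  calc _ ≤ ∑ p ∈ (Finset.range n).offDiag, (D * D + D * D) := by
        refine Finset.sum_le_sum fun p hp => ?_
        rw [Finset.sum_add_distrib, Finset.sum_ite_eq', Finset.sum_ite_eq']
        have hnn : 0 ≤ D * D := mul_self_nonneg D
        split_ifs <;> linarith
    _ = _ := by
        rw [Finset.sum_const, nsmul_eq_mul, hcard]; ring

/-- Hoeffding decomposition of the sum over the ordered pairs of distinct indices. -/
lemma sum_offDiag_projection (n : ℕ) (h : ℕ → ℕ → ℝ) (f : ℕ → ℝ) (μ : ℝ) :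
    ∑ p ∈ (Finset.range n).offDiag, (h p.1 p.2 - f p.1 - f p.2 + μ)
      = ∑ p ∈ (Finset.range n).offDiag, h p.1 p.2
        - 2 * (n - 1) * ∑ a ∈ Finset.range n, f a + n * (n - 1) * μ := by
  rw [sum_offDiag_eq _ (fun a b => h a b - f a - f b + μ), sum_offDiag_eq]
  simp only [Finset.sum_add_distrib, Finset.sum_sub_distrib, Finset.sum_const, Finset.card_range,
    nsmul_eq_mul, ← Finset.mul_sum]
  ring

/-- Central limit theorem for `U`-statistics of order two with a bounded symmetric kernel. -/
theorem tendstoInDistribution_uStatistic (hX : ∀ j, Measurable (X j))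
    (hlaw : ∀ j, P.map (X j) = Q) (hind : iIndepFun X P) {h : S → S → ℝ}
    (hh : Measurable (Function.uncurry h)) {C : ℝ} (hC : ∀ x y, |h x y| ≤ C)
    (hsymm : ∀ x y, h x y = h y x) :
    TendstoInDistribution
      (fun (n : ℕ) ω => √n * ((∑ p ∈ (Finset.range n).offDiag, h (X p.1 ω) (X p.2 ω)) / (n * (n - 1))
        - ∫ x, ∫ y, h x y ∂Q ∂Q)) atTop (id : ℝ → ℝ) (fun _ => P)
      (gaussianReal 0 Var[fun x => 2 * ∫ y, h x y ∂Q; Q].toNNReal) := by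
  set f : S → ℝ := fun x => ∫ y, h x y ∂Q with hf
  set μ : ℝ := ∫ x, f x ∂Q with hμ
  have hfm : Measurable f := hh.stronglyMeasurable.integral_prod_right.measurable
  have hint : ∀ x, Integrable (h x) Q := fun x =>
    Integrable.of_bound (hh.comp (measurable_const.prodMk measurable_id)).aestronglyMeasurable C
      (ae_of_all _ fun y => hC x y)
  have hfC : ∀ x, |f x| ≤ C := fun x => by
    simpa using norm_integral_le_of_norm_le_const (μ := Q) (f := h x) (ae_of_all _ (hC x))
  have hfint : Integrable f Q :=
    Integrable.of_bound hfm.aestronglyMeasurable C (ae_of_all _ fun y => hfC y)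
  have hμC : |μ| ≤ C := by
    simpa using norm_integral_le_of_norm_le_const (μ := Q) (f := f) (ae_of_all _ hfC)
  let g : S → S → ℝ := fun x y => h x y - f x - f y + μ
  have hgm : Measurable (Function.uncurry g) :=
    ((hh.sub (hfm.comp measurable_fst)).sub (hfm.comp measurable_snd)).add_const _
  have hgD : ∀ x y, |g x y| ≤ 4 * C := fun x y => by
    have h1 := abs_le.1 (hC x y)
    have h2 := abs_le.1 (hfC x)
    have h3 := abs_le.1 (hfC y)
    have h4 := abs_le.1 hμC
    rw [abs_le]
    constructor <;> simp only [g] <;> linarith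
  have hgs : ∀ x y, g x y = g y x := fun x y => by simp only [g, hsymm x y]; ring
  have hgdeg : ∀ x, ∫ y, g x y ∂Q = 0 := fun x => by
    simp only [g]
    have i1 : Integrable (fun y => h x y - f x) Q := (hint x).sub (integrable_const _)
    have i2 : Integrable (fun y => h x y - f x - f y) Q := i1.sub hfint
    rw [integral_add i2 (integrable_const _), integral_sub i1 hfint,
      integral_sub (hint x) (integrable_const _)]
    simp [f, μ]
  have hYm : Measurable fun x => 2 * f x := hfm.const_mul 2
  have hid : ∀ j, IdentDistrib (fun ω => 2 * f (X j ω)) (fun ω => 2 * f (X 0 ω)) P P := fun j =>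
    IdentDistrib.comp (u := fun x => 2 * f x)
      ⟨(hX j).aemeasurable, (hX 0).aemeasurable, by rw [hlaw, hlaw]⟩ hYm
  have hvar : Var[fun ω => 2 * f (X 0 ω); P] = Var[fun x => 2 * f x; Q] := by
    rw [← hlaw 0, variance_map hYm.aemeasurable (hX 0).aemeasurable]; rfl
  have hmean : ∫ ω, 2 * f (X 0 ω) ∂P = 2 * μ := by
    rw [hμ, ← integral_const_mul, ← hlaw 0, integral_map (hX 0).aemeasurable
      hYm.aestronglyMeasurable]
  have hclt := tendstoInDistribution_inv_sqrt_mul_sum_sub (P := P)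
    (X := fun j ω => 2 * f (X j ω)) (Y := (id : ℝ → ℝ))
    (P' := gaussianReal 0 Var[fun x => 2 * f x; Q].toNNReal)
    ⟨aemeasurable_id, by rw [hvar]; exact Measure.map_id⟩
    (MemLp.of_bound (hYm.comp (hX 0)).aestronglyMeasurable (2 * C) (ae_of_all _ fun ω => by
      rw [norm_mul]; simpa using hfC (X 0 ω)))
    (hind.comp (fun _ x => 2 * f x) fun _ => hYm) hid
  simp only [hmean] at hclt
  have hsum : ∀ n, Measurable fun ω =>
      ∑ p ∈ (Finset.range n).offDiag, h (X p.1 ω) (X p.2 ω) := fun n =>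
    Finset.measurable_sum _ fun p _ =>
      hh.comp (f := fun ω => (X p.1 ω, X p.2 ω)) ((hX p.1).prodMk (hX p.2))
  -- Slutsky: it suffices that the difference from the normalized sum of the `2 f (X k)` tends to
  -- zero in probability.
  refine tendstoInDistribution_of_tendstoInMeasure_sub _ _ hclt ?_
    fun n => (((hsum n).div_const _).sub_const _ |>.const_mul _).aemeasurable
  have hgsum : ∀ n, Measurable fun ω =>
      ∑ p ∈ (Finset.range n).offDiag, g (X p.1 ω) (X p.2 ω) := fun n =>
    Finset.measurable_sum _ fun p _ =>
      hgm.comp (f := fun ω => (X p.1 ω, X p.2 ω)) ((hX p.1).prodMk (hX p.2))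
  rw [tendstoInMeasure_iff_measureReal_norm]
  intro ε hε
  -- The Chebyshev bound: `(√n / (n (n - 1)))²` times the second moment bound `2 n (n - 1) (4 C)²`,
  -- divided by `ε²`.
  have hlim : Tendsto (fun n : ℕ => (2 * ((4 * C) * (4 * C)) / ε ^ 2) * ((n : ℝ) - 1)⁻¹) atTop (𝓝 0) := by
    have : Tendsto (fun n : ℕ => ((n : ℝ) - 1)⁻¹) atTop (𝓝 0) :=
      tendsto_inv_atTop_zero.comp (tendsto_atTop_add_const_right _ _ tendsto_natCast_atTop_atTop)
    simpa using this.const_mul (2 * ((4 * C) * (4 * C)) / ε ^ 2)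
  refine squeeze_zero' (Eventually.of_forall fun n => measureReal_nonneg) ?_ hlim
  filter_upwards [eventually_ge_atTop 2] with n hn
  have hn' : (2 : ℝ) ≤ n := by exact_mod_cast hn
  have hn0 : (0 : ℝ) < n := by linarith
  have hn1 : (0 : ℝ) < n - 1 := by linarith
  have hs : √(n : ℝ) * √n = n := Real.mul_self_sqrt hn0.le
  have hs0 : 0 < √(n : ℝ) := Real.sqrt_pos.2 hn0
  set R : Ω → ℝ := fun ω => ∑ p ∈ (Finset.range n).offDiag, g (X p.1 ω) (X p.2 ω) with hR
  have hdiff : ∀ ω, √n * ((∑ p ∈ (Finset.range n).offDiag, h (X p.1 ω) (X p.2 ω)) / (n * (n - 1)) - μ)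
      - (√n)⁻¹ * (∑ k ∈ Finset.range n, 2 * f (X k ω) - n * (2 * μ))
      = √n / (n * (n - 1)) * R ω := fun ω => by
    have := sum_offDiag_projection n (fun a b => h (X a ω) (X b ω)) (fun a => f (X a ω)) μ
    simp only [hR, g, this, ← Finset.mul_sum]
    have e : (√(n : ℝ))⁻¹ = √n / n := by
      field_simp; rw [sq]; exact hs.symm
    rw [e]
    field_simp
    ring
  have hRint : Integrable (fun ω => (√n / (n * (n - 1)) * R ω) ^ 2) P := by
    have hb : ∀ ω, ‖(√n / (n * (n - 1)) * R ω) ^ 2‖ ≤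
        (√n / (n * (n - 1)) * ∑ p ∈ (Finset.range n).offDiag, 4 * C) ^ 2 := fun ω => by
      rw [norm_pow, norm_mul, Real.norm_eq_abs, Real.norm_eq_abs,
        abs_of_nonneg (by positivity : 0 ≤ √(n : ℝ) / (n * (n - 1)))]
      gcongr
      exact (Finset.abs_sum_le_sum_abs _ _).trans (Finset.sum_le_sum fun p _ => hgD _ _)
    exact Integrable.of_bound (((hgsum n).const_mul _).pow_const 2).aestronglyMeasurable _
      (ae_of_all _ hb)
  have hmarkov := mul_meas_ge_le_integral_of_nonneg (μ := P)
    (f := fun ω => (√n / (n * (n - 1)) * R ω) ^ 2) (ae_of_all _ fun ω => sq_nonneg _) hRint (ε ^ 2)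
  have hset : {ω | ε ≤ ‖(√n * ((∑ p ∈ (Finset.range n).offDiag, h (X p.1 ω) (X p.2 ω)) / (n * (n - 1)) - μ)
      - (√n)⁻¹ * (∑ k ∈ Finset.range n, 2 * f (X k ω) - n * (2 * μ)))‖}
      = {ω | ε ^ 2 ≤ (√n / (n * (n - 1)) * R ω) ^ 2} := by
    ext ω
    simp only [Set.mem_ofPred_eq, hdiff, Real.norm_eq_abs]
    rw [← sq_abs (√n / (n * (n - 1)) * R ω)]
    exact (pow_le_pow_iff_left₀ hε.le (abs_nonneg _) two_ne_zero).symm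
  simp only [Pi.sub_apply, Pi.zero_apply, sub_zero]
  rw [hset]
  have hsq : ∫ ω, (√n / (n * (n - 1)) * R ω) ^ 2 ∂P ≤ 2 * ((4 * C) * (4 * C)) * ((n : ℝ) - 1)⁻¹ := by
    simp_rw [mul_pow, integral_const_mul]
    have := integral_sq_sum_degenerate_le hX hlaw hind hgm hgD hgs hgdeg n
    calc _ ≤ (√n / (n * (n - 1))) ^ 2 * (2 * (n * (n - 1)) * ((4 * C) * (4 * C))) := by
          gcongr
      _ = _ := by
          rw [div_pow, Real.sq_sqrt hn0.le]
          field_simp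
  rw [div_mul_eq_mul_div, le_div_iff₀ (by positivity), mul_comm]
  exact hmarkov.trans hsq

end UStatistic

/-! ### Arc probabilities and moments on the unit interval -/

/-- Arc indicator of an end interval, where `u` and `v` are the distances of the two points to the
finite end in units of the length of the interval. -/
noncomputable def arcInd (τ u v : ℝ) : ℝ :=
  Set.indicator {p : ℝ × ℝ | (1 - τ) * p.1 < p.2 ∧ p.2 < (1 + τ) * p.1} 1 (u, v)

/-- Symmetrized arc indicator of an end interval. -/
noncomputable def unitKernel (τ u v : ℝ) : ℝ := (arcInd τ u v + arcInd τ v u) / 2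

/-- The uniform distribution on the unit interval. -/
noncomputable def unitUniform : Measure ℝ := volume.restrict (Set.Ioo 0 1)

instance : IsProbabilityMeasure unitUniform := ⟨by simp [unitUniform]⟩

lemma measurable_arcInd (τ : ℝ) : Measurable (Function.uncurry (arcInd τ)) := by
  refine measurable_const.indicator ?_
  rw [Set.ofPred_and]
  exact (measurableSet_lt (by fun_prop) (by fun_prop)).inter
    (measurableSet_lt (by fun_prop) (by fun_prop))

lemma measurable_unitKernel (τ : ℝ) : Measurable (Function.uncurry (unitKernel τ)) :=
  ((measurable_arcInd τ).add ((measurable_arcInd τ).comp measurable_swap)).div_const 2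

lemma arcInd_nonneg (τ u v : ℝ) : 0 ≤ arcInd τ u v := by
  unfold arcInd Set.indicator; split_ifs <;> simp

lemma arcInd_le_one (τ u v : ℝ) : arcInd τ u v ≤ 1 := by
  unfold arcInd Set.indicator; split_ifs <;> simp

lemma abs_unitKernel_le (τ u v : ℝ) : |unitKernel τ u v| ≤ 1 := by
  have := arcInd_nonneg τ u v
  have := arcInd_nonneg τ v u
  have := arcInd_le_one τ u v
  have := arcInd_le_one τ v u
  rw [abs_le]; unfold unitKernel
  constructor <;> linarith

lemma unitKernel_symm (τ u v : ℝ) : unitKernel τ u v = unitKernel τ v u := by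
  unfold unitKernel; ring

lemma integral_unitUniform (f : ℝ → ℝ) : ∫ x, f x ∂unitUniform = ∫ x in (0 : ℝ)..1, f x := by
  rw [unitUniform, intervalIntegral.integral_of_le zero_le_one, integral_Ioc_eq_integral_Ioo]

/-- Conditional probability of an arc from a point. -/
noncomputable def outProb (τ u : ℝ) : ℝ := min 1 ((1 + τ) * u) - max 0 ((1 - τ) * u)

/-- Conditional probability of an arc to a point. -/
noncomputable def inProb (τ u : ℝ) : ℝ := (if τ < 1 then min 1 (u / (1 - τ)) else 1) - u / (1 + τ)

lemma integral_indicator_unitUniform {A : Set ℝ} {a b : ℝ} (hab : a ≤ b)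
    (hA : A ∩ Set.Ioo 0 1 = Set.Ioo a b) (hAm : MeasurableSet A) :
    ∫ v, A.indicator 1 v ∂unitUniform = b - a := by
  rw [integral_indicator_one hAm, unitUniform, measureReal_restrict_apply hAm, hA,
    Real.volume_real_Ioo_of_le hab]

lemma integral_arcInd_right {τ u : ℝ} (hτ : 0 < τ) (hu : u ∈ Set.Ioo (0 : ℝ) 1) :
    ∫ v, arcInd τ u v ∂unitUniform = outProb τ u := by
  obtain ⟨h0, h1⟩ := hu
  have hτu : 0 < τ * u := mul_pos hτ h0
  refine integral_indicator_unitUniform (A := {v | (1 - τ) * u < v ∧ v < (1 + τ) * u}) ?_ ?_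
    measurableSet_Ioo
  · refine max_le (le_min zero_le_one (by nlinarith)) (le_min ?_ ?_) <;> nlinarith
  · ext v
    simp only [Set.mem_inter_iff, Set.mem_ofPred_eq, Set.mem_Ioo, max_lt_iff, lt_min_iff]
    tauto

/-- The admissible sources `v` form the interval from `u / (1 + τ)` to `u / (1 - τ)`, cut off at
`1`. For `τ ≥ 1` the condition `(1 - τ) v < u` always holds, hence the case distinction in `inProb`.
-/
lemma integral_arcInd_left {τ u : ℝ} (hτ : 0 < τ) (hu : u ∈ Set.Ioo (0 : ℝ) 1) :
    ∫ v, arcInd τ v u ∂unitUniform = inProb τ u := by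
  obtain ⟨h0, h1⟩ := hu
  have hτu : 0 < τ * u := mul_pos hτ h0
  have hτ1 : 0 < 1 + τ := by linarith
  have hmeas : MeasurableSet {v | (1 - τ) * v < u ∧ u < (1 + τ) * v} := by
    rw [Set.ofPred_and]
    exact (measurableSet_lt (by fun_prop) (by fun_prop)).inter
      (measurableSet_lt (by fun_prop) (by fun_prop))
  refine integral_indicator_unitUniform (A := {v | (1 - τ) * v < u ∧ u < (1 + τ) * v}) ?_ ?_ hmeas
  · have h2 : u / (1 + τ) ≤ 1 := by rw [div_le_one hτ1]; linarith
    split_ifs with h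
    · refine le_min h2 ?_
      gcongr <;> linarith
    · exact h2
  · ext v
    simp only [Set.mem_inter_iff, Set.mem_ofPred_eq, Set.mem_Ioo, div_lt_iff₀ hτ1]
    split_ifs with h
    · rw [lt_min_iff, lt_div_iff₀ (by linarith)]
      constructor
      · rintro ⟨⟨h2, h3⟩, h4, h5⟩
        exact ⟨by linarith, h5, by linarith⟩
      · rintro ⟨h2, h3, h4⟩
        exact ⟨⟨by linarith, by linarith⟩, by nlinarith, h3⟩
    · constructor
      · rintro ⟨⟨h2, h3⟩, h4, h5⟩
        exact ⟨by linarith, h5⟩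
      · rintro ⟨h2, h3⟩
        have hv : 0 < v := by nlinarith
        exact ⟨⟨by nlinarith, by linarith⟩, hv, h3⟩

lemma continuous_outProb (τ : ℝ) : Continuous (outProb τ) := by unfold outProb; fun_prop

lemma continuous_inProb (τ : ℝ) : Continuous (inProb τ) := by
  unfold inProb; split_ifs <;> fun_prop

lemma integral_linear (a b p q : ℝ) :
    ∫ x in a..b, (p * x + q) = p * (b ^ 2 - a ^ 2) / 2 + q * (b - a) := by
  rw [intervalIntegral.integral_add (Continuous.intervalIntegrable (by fun_prop) _ _)
    (Continuous.intervalIntegrable (by fun_prop) _ _), intervalIntegral.integral_const_mul,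
    integral_id, intervalIntegral.integral_const, smul_eq_mul]
  ring

lemma integral_linear_sq (a b p q : ℝ) :
    ∫ x in a..b, (p * x + q) ^ 2
      = p ^ 2 * (b ^ 3 - a ^ 3) / 3 + p * q * (b ^ 2 - a ^ 2) + q ^ 2 * (b - a) := by
  have h : ∀ x : ℝ, (p * x + q) ^ 2 = p ^ 2 * x ^ 2 + (2 * p * q * x + q ^ 2) := fun x => by ring
  simp_rw [h]
  rw [intervalIntegral.integral_add (Continuous.intervalIntegrable (by fun_prop) _ _)
    (Continuous.intervalIntegrable (by fun_prop) _ _), intervalIntegral.integral_const_mul,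
    integral_pow, integral_linear]
  norm_num
  ring

lemma integral_congr_of_le {f g : ℝ → ℝ} {a b : ℝ} (hab : a ≤ b)
    (h : ∀ x, a ≤ x → x ≤ b → f x = g x) : ∫ x in a..b, f x = ∫ x in a..b, g x :=
  intervalIntegral.integral_congr fun x hx => by
    rw [Set.uIcc_of_le hab] at hx
    exact h x hx.1 hx.2

/-- The integrand is linear on each side of `1 / (1 + τ)`, the point where `(1 + τ) u` reaches `1`.
-/
lemma integral_outProb {τ : ℝ} (hτ : 0 < τ) : ∫ u, outProb τ u ∂unitUniform = endMean τ := by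
  have hτ1 : 0 < 1 + τ := by linarith
  have ha0 : 0 ≤ 1 / (1 + τ) := by positivity
  have ha1 : 1 / (1 + τ) ≤ 1 := by rw [div_le_one hτ1]; linarith
  have hc := continuous_outProb τ
  rw [integral_unitUniform, ← intervalIntegral.integral_add_adjacent_intervals
    (hc.intervalIntegrable 0 (1 / (1 + τ))) (hc.intervalIntegrable (1 / (1 + τ)) 1)]
  unfold endMean
  split_ifs with h
  · rw [integral_congr_of_le (g := fun u => 2 * τ * u + 0) ha0 fun x h0 h1 => ?_,
      integral_congr_of_le (g := fun u => (τ - 1) * u + 1) ha1 fun x h0 h1 => ?_,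
      integral_linear, integral_linear]
    · field_simp; ring
    · rw [div_le_iff₀ hτ1] at h0
      have : 0 ≤ x := by nlinarith
      rw [outProb, min_eq_left (by linarith), max_eq_right (by nlinarith)]; ring
    · rw [le_div_iff₀ hτ1] at h1
      rw [outProb, min_eq_right (by linarith), max_eq_right (by nlinarith)]; ring
  · rw [integral_congr_of_le (g := fun u => (1 + τ) * u + 0) ha0 fun x h0 h1 => ?_,
      integral_congr_of_le (g := fun u => 0 * u + 1) ha1 fun x h0 h1 => ?_,
      integral_linear, integral_linear]
    · field_simp; ring
    · rw [div_le_iff₀ hτ1] at h0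
      have : 0 ≤ x := by nlinarith
      rw [outProb, min_eq_left (by linarith), max_eq_left (by nlinarith)]; ring
    · rw [le_div_iff₀ hτ1] at h1
      rw [outProb, min_eq_right (by linarith), max_eq_left (by nlinarith)]; ring

/-- The right side is variance plus squared mean, since the sum has mean `2 * endMean τ`. For `τ <
1`, `inProb` adds the breakpoint `1 - τ`, which lies left of `1 / (1 + τ)` because `(1 - τ) (1 + τ)
≤ 1`. -/
lemma integral_sq_outProb_add_inProb {τ : ℝ} (hτ : 0 < τ) :
    ∫ u, (outProb τ u + inProb τ u) ^ 2 ∂unitUniform = endVariance τ + (2 * endMean τ) ^ 2 := by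
  have hτ1 : 0 < 1 + τ := by linarith
  have ha0 : 0 ≤ 1 / (1 + τ) := by positivity
  have ha1 : 1 / (1 + τ) ≤ 1 := by rw [div_le_one hτ1]; linarith
  have hc : Continuous fun u => (outProb τ u + inProb τ u) ^ 2 :=
    ((continuous_outProb τ).add (continuous_inProb τ)).pow 2
  rw [integral_unitUniform, ← intervalIntegral.integral_add_adjacent_intervals
    (hc.intervalIntegrable 0 (1 / (1 + τ))) (hc.intervalIntegrable (1 / (1 + τ)) 1)]
  unfold endMean endVariance
  split_ifs with h
  · have hτ2 : 0 < 1 - τ := by linarith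
    have hb : 1 - τ ≤ 1 / (1 + τ) := by rw [le_div_iff₀ hτ1]; nlinarith
    rw [← intervalIntegral.integral_add_adjacent_intervals
      (hc.intervalIntegrable 0 (1 - τ)) (hc.intervalIntegrable (1 - τ) (1 / (1 + τ)))]
    rw [integral_congr_of_le
        (g := fun u => ((2 * τ + 1 / (1 - τ) - 1 / (1 + τ)) * u + 0) ^ 2) hτ2.le fun x h0 h1 => ?_,
      integral_congr_of_le
        (g := fun u => ((2 * τ - 1 / (1 + τ)) * u + 1) ^ 2) hb fun x h0 h1 => ?_,
      integral_congr_of_le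
        (g := fun u => ((τ - 1 - 1 / (1 + τ)) * u + 2) ^ 2) ha1 fun x h0 h1 => ?_,
      integral_linear_sq, integral_linear_sq, integral_linear_sq]
    · field_simp; ring
    · have h2 : 1 ≤ x / (1 - τ) := by rw [le_div_iff₀ hτ2]; linarith
      rw [div_le_iff₀ hτ1] at h0
      have : 0 ≤ x := by nlinarith
      rw [outProb, inProb, if_pos h, min_eq_left (by linarith), max_eq_right (by nlinarith),
        min_eq_left h2]; ring
    · have h2 : 1 ≤ x / (1 - τ) := by rw [le_div_iff₀ hτ2]; linarith
      rw [le_div_iff₀ hτ1] at h1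
      rw [outProb, inProb, if_pos h, min_eq_right (by linarith), max_eq_right (by nlinarith),
        min_eq_left h2]; ring
    · have h2 : x / (1 - τ) ≤ 1 := by rw [div_le_iff₀ hτ2]; linarith
      have h3 := (le_div_iff₀ hτ1).1 (h1.trans hb)
      rw [outProb, inProb, if_pos h, min_eq_right (by linarith), max_eq_right (by nlinarith),
        min_eq_right h2]; ring
  · rw [integral_congr_of_le
        (g := fun u => ((1 + τ - 1 / (1 + τ)) * u + 1) ^ 2) ha0 fun x h0 h1 => ?_,
      integral_congr_of_le (g := fun u => (-(1 / (1 + τ)) * u + 2) ^ 2) ha1 fun x h0 h1 => ?_,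
      integral_linear_sq, integral_linear_sq]
    · field_simp; ring
    · rw [div_le_iff₀ hτ1] at h0
      have : 0 ≤ x := by nlinarith
      rw [outProb, inProb, if_neg h, min_eq_left (by linarith), max_eq_left (by nlinarith)]; ring
    · rw [le_div_iff₀ hτ1] at h1
      rw [outProb, inProb, if_neg h, min_eq_right (by linarith), max_eq_left (by nlinarith)]; ring

lemma endVariance_pos {τ : ℝ} (hτ : 0 < τ) : 0 < endVariance τ := by
  unfold endVariance
  split_ifs with h
  · have h2 : τ ^ 2 < 1 := by nlinarith
    have h3 : τ ^ 3 < τ := by nlinarith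
    have h4 : τ ^ 4 < 1 := by nlinarith
    -- From `2 τ⁴ + 4 τ³ + τ² < 2 + 4 τ + 1` the factor even exceeds `1`.
    have : 0 < 4 * τ + 4 - 2 * τ ^ 4 - 4 * τ ^ 3 - τ ^ 2 := by linarith
    positivity
  · positivity

lemma ae_unitUniform_mem : ∀ᵐ u ∂unitUniform, u ∈ Set.Ioo (0 : ℝ) 1 :=
  ae_restrict_mem measurableSet_Ioo

lemma integrable_arcInd (τ : ℝ) :
    Integrable (Function.uncurry (arcInd τ)) (unitUniform.prod unitUniform) :=
  Integrable.of_bound (measurable_arcInd τ).aestronglyMeasurable 1 (ae_of_all _ fun p => by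
    simpa [Function.uncurry, abs_of_nonneg (arcInd_nonneg τ p.1 p.2)] using
      arcInd_le_one τ p.1 p.2)

lemma integral_integral_arcInd {τ : ℝ} (hτ : 0 < τ) :
    ∫ u, ∫ v, arcInd τ u v ∂unitUniform ∂unitUniform = endMean τ := by
  rw [← integral_outProb hτ]
  exact integral_congr_ae (ae_unitUniform_mem.mono fun u hu => integral_arcInd_right hτ hu)

lemma two_mul_integral_unitKernel {τ u : ℝ} (hτ : 0 < τ) (hu : u ∈ Set.Ioo (0 : ℝ) 1) :
    2 * ∫ v, unitKernel τ u v ∂unitUniform = outProb τ u + inProb τ u := by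
  have hb : ∀ a b, ‖arcInd τ a b‖ ≤ 1 := fun a b => by
    rw [Real.norm_eq_abs, abs_of_nonneg (arcInd_nonneg τ a b)]; exact arcInd_le_one τ a b
  simp only [unitKernel]
  rw [integral_div, integral_add, integral_arcInd_right hτ hu, integral_arcInd_left hτ hu]
  · ring
  · exact Integrable.of_bound ((measurable_arcInd τ).comp
      (measurable_const.prodMk measurable_id)).aestronglyMeasurable 1 (ae_of_all _ fun v => hb u v)
  · exact Integrable.of_bound ((measurable_arcInd τ).comp
      (measurable_id.prodMk measurable_const)).aestronglyMeasurable 1 (ae_of_all _ fun v => hb v u)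

/-- By Fubini, incoming and outgoing arc probabilities have the same mean, so no second piecewise
integration is needed. -/
lemma integral_inProb {τ : ℝ} (hτ : 0 < τ) : ∫ u, inProb τ u ∂unitUniform = endMean τ := by
  rw [← integral_integral_arcInd hτ, integral_integral_swap (integrable_arcInd τ)]
  exact integral_congr_ae (ae_unitUniform_mem.mono fun u hu => (integral_arcInd_left hτ hu).symm)

lemma integrable_unitUniform {f : ℝ → ℝ} (hf : Continuous f) : Integrable f unitUniform :=
  (hf.integrableOn_Icc (a := 0) (b := 1)).mono_set Set.Ioo_subset_Icc_self

lemma integral_two_mul_integral_unitKernel {τ : ℝ} (hτ : 0 < τ) :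
    ∫ u, 2 * ∫ v, unitKernel τ u v ∂unitUniform ∂unitUniform = 2 * endMean τ := by
  rw [integral_congr_ae (ae_unitUniform_mem.mono fun u hu => two_mul_integral_unitKernel hτ hu),
    integral_add (integrable_unitUniform (continuous_outProb τ))
      (integrable_unitUniform (continuous_inProb τ)), integral_outProb hτ, integral_inProb hτ]
  ring

lemma integral_integral_unitKernel {τ : ℝ} (hτ : 0 < τ) :
    ∫ u, ∫ v, unitKernel τ u v ∂unitUniform ∂unitUniform = endMean τ := by
  have := integral_two_mul_integral_unitKernel hτ
  rw [integral_const_mul] at this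
  linarith

lemma variance_two_mul_integral_unitKernel {τ : ℝ} (hτ : 0 < τ) :
    Var[fun u => 2 * ∫ v, unitKernel τ u v ∂unitUniform; unitUniform] = endVariance τ := by
  have hae : (fun u => 2 * ∫ v, unitKernel τ u v ∂unitUniform) =ᵐ[unitUniform]
      fun u => outProb τ u + inProb τ u :=
    ae_unitUniform_mem.mono fun u hu => two_mul_integral_unitKernel hτ hu
  have hc := (continuous_outProb τ).add (continuous_inProb τ)
  rw [variance_congr hae, variance_eq_sub]
  · have h1 := integral_congr_ae hae
    rw [integral_two_mul_integral_unitKernel hτ] at h1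
    rw [← h1]
    simp only [Pi.pow_apply]
    rw [integral_sq_outProb_add_inProb hτ]
    ring
  · exact (memLp_two_iff_integrable_sq hc.aestronglyMeasurable).2
      (integrable_unitUniform (hc.pow 2))

/-! ### Reduction of an end interval to the unit interval -/

/-- The affine map `x ↦ α x + β` identifies the interval `A` with the unit interval, in such a way
that the proximity map `N` corresponds to `arcInd τ`. -/
structure IsUnitCoordinate (A : Set ℝ) (N : ℝ → Set ℝ) (τ α β : ℝ) : Prop where
  ne_zero : α ≠ 0
  mem_iff : ∀ x, x ∈ A ↔ α * x + β ∈ Set.Ioo (0 : ℝ) 1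
  mem_region_iff : ∀ x ∈ A, ∀ z ∈ A, z ∈ N x ↔
    (1 - τ) * (α * x + β) < α * z + β ∧ α * z + β < (1 + τ) * (α * x + β)

lemma cellIndex_eq_one {Y : Finset ℝ} {x : ℝ} (h : ∀ y ∈ Y, x < y) : cellIndex Y x = 1 := by
  simp only [cellIndex, Nat.add_eq_right, Finset.card_eq_zero, Finset.filter_eq_empty_iff, not_lt]
  exact fun y hy => (h y hy).le

lemma cellIndex_eq_card_add_one {Y : Finset ℝ} {x : ℝ} (h : ∀ y ∈ Y, y < x) :
    cellIndex Y x = Y.card + 1 := by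
  rw [cellIndex, Finset.filter_true_of_mem h]

lemma orderStat_one (δ₁ δ₂ : ℝ) {Y : Finset ℝ} (hY : Y.Nonempty) :
    orderStat δ₁ δ₂ Y 1 = Y.min' hY := by
  have h := Finset.card_pos.2 hY
  simp only [orderStat, one_ne_zero, if_false, Nat.sub_self, h, dif_pos]
  exact Finset.orderEmbOfFin_zero rfl h

lemma orderStat_card (δ₁ δ₂ : ℝ) {Y : Finset ℝ} (hY : Y.Nonempty) :
    orderStat δ₁ δ₂ Y Y.card = Y.max' hY := by
  have h := Finset.card_pos.2 hY
  simp only [orderStat, h.ne', if_false, Nat.sub_lt h one_pos, dif_pos]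
  exact Finset.orderEmbOfFin_last rfl h

lemma orderStat_card_add_one (δ₁ δ₂ : ℝ) (Y : Finset ℝ) :
    orderStat δ₁ δ₂ Y (Y.card + 1) = δ₂ := by
  simp [orderStat]

/-- The coordinate is the scaled distance `(y - x) / (y - δ)`, hence the negative slope. -/
lemma isUnitCoordinate_left {δ y τ : ℝ} {N : ℝ → Set ℝ} (hδ : δ < y)
    (hN : ∀ x ∈ Set.Ioo δ y, N x = leftEndRegion y τ x) :
    IsUnitCoordinate (Set.Ioo δ y) N τ (-(y - δ)⁻¹) (y * (y - δ)⁻¹) := by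
  have hd : 0 < y - δ := sub_pos.2 hδ
  have e : ∀ x, -(y - δ)⁻¹ * x + y * (y - δ)⁻¹ = (y - x) / (y - δ) := fun x => by
    field_simp; ring
  refine ⟨neg_ne_zero.2 (inv_ne_zero hd.ne'), fun x => ?_, fun x hx z hz => ?_⟩
  · rw [e, Set.mem_Ioo, Set.mem_Ioo, div_pos_iff_of_pos_right hd, div_lt_one hd]
    constructor <;> rintro ⟨h1, h2⟩ <;> constructor <;> linarith
  · rw [e, e, hN x hx, ← mul_div_assoc, ← mul_div_assoc, div_lt_div_iff_of_pos_right hd,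
      div_lt_div_iff_of_pos_right hd, leftEndRegion]
    obtain ⟨h1, h2⟩ := hx
    split_ifs with h <;> rw [Set.mem_Ioo]
    · constructor <;> rintro ⟨h3, h4⟩ <;> constructor <;> linarith
    -- For `τ ≥ 1` the region reaches up to `y`; correspondingly `(1 - τ) (y - x) ≤ 0 < y - z`, so
    -- the lower bound in the unit coordinate holds automatically.
    · have h5 : (1 - τ) * (y - x) ≤ 0 := by nlinarith
      constructor <;> rintro ⟨h3, h4⟩ <;> constructor <;> linarith [hz.2]

lemma isUnitCoordinate_right {δ y τ : ℝ} {N : ℝ → Set ℝ} (hδ : y < δ)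
    (hN : ∀ x ∈ Set.Ioo y δ, N x = rightEndRegion y τ x) :
    IsUnitCoordinate (Set.Ioo y δ) N τ (δ - y)⁻¹ (-y * (δ - y)⁻¹) := by
  have hd : 0 < δ - y := sub_pos.2 hδ
  have e : ∀ x, (δ - y)⁻¹ * x + -y * (δ - y)⁻¹ = (x - y) / (δ - y) := fun x => by
    field_simp; ring
  refine ⟨inv_ne_zero hd.ne', fun x => ?_, fun x hx z hz => ?_⟩
  · rw [e, Set.mem_Ioo, Set.mem_Ioo, div_pos_iff_of_pos_right hd, div_lt_one hd]
    constructor <;> rintro ⟨h1, h2⟩ <;> constructor <;> linarith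
  · rw [e, e, hN x hx, ← mul_div_assoc, ← mul_div_assoc, div_lt_div_iff_of_pos_right hd,
      div_lt_div_iff_of_pos_right hd, rightEndRegion]
    obtain ⟨h1, h2⟩ := hx
    split_ifs with h <;> rw [Set.mem_Ioo]
    · constructor <;> rintro ⟨h3, h4⟩ <;> constructor <;> linarith
    · have h5 : (1 - τ) * (x - y) ≤ 0 := by nlinarith
      constructor <;> rintro ⟨h3, h4⟩ <;> constructor <;> linarith [hz.1]

/-- An end interval is a proper subinterval of `(δ₁, δ₂)` that has a unit coordinate. -/
lemma exists_unitCoordinate {δ₁ δ₂ : ℝ} {Y : Finset ℝ} (hYne : Y.Nonempty)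
    (hY : ∀ y ∈ Y, y ∈ Set.Ioo δ₁ δ₂) (τ c : ℝ) {i : ℕ} (hi : i = 1 ∨ i = Y.card + 1) :
    ∃ l r α β, δ₁ ≤ l ∧ l < r ∧ r ≤ δ₂ ∧ r - l < δ₂ - δ₁ ∧ cell δ₁ δ₂ Y i = Set.Ioo l r ∧
      IsUnitCoordinate (cell δ₁ δ₂ Y i) (proximityRegion δ₁ δ₂ Y τ c) τ α β := by
  rcases hi with rfl | rfl
  · have hm := hY _ (Y.min'_mem hYne)
    have hcell : cell δ₁ δ₂ Y 1 = Set.Ioo δ₁ (Y.min' hYne) := by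
      rw [cell, orderStat_one δ₁ δ₂ hYne]; simp [orderStat]
    refine ⟨δ₁, Y.min' hYne, -(Y.min' hYne - δ₁)⁻¹, Y.min' hYne * (Y.min' hYne - δ₁)⁻¹, le_rfl,
      hm.1, hm.2.le, by linarith [hm.2], hcell, ?_⟩
    rw [hcell]
    refine isUnitCoordinate_left hm.1 fun x hx => ?_
    have hlt : ∀ y ∈ Y, x < y := fun y hy => hx.2.trans_le (Y.min'_le y hy)
    rw [proximityRegion, if_neg fun h => lt_irrefl _ (hlt x h), if_pos (cellIndex_eq_one hlt),
      orderStat_one δ₁ δ₂ hYne]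
  · have hm := hY _ (Y.max'_mem hYne)
    have hcell : cell δ₁ δ₂ Y (Y.card + 1) = Set.Ioo (Y.max' hYne) δ₂ := by
      rw [cell, orderStat_card_add_one, Nat.add_sub_cancel, orderStat_card δ₁ δ₂ hYne]
    refine ⟨Y.max' hYne, δ₂, (δ₂ - Y.max' hYne)⁻¹, -Y.max' hYne * (δ₂ - Y.max' hYne)⁻¹, hm.1.le,
      hm.2, le_rfl, by linarith [hm.1], hcell, ?_⟩
    rw [hcell]
    refine isUnitCoordinate_right hm.2 fun x hx => ?_
    have hlt : ∀ y ∈ Y, y < x := fun y hy => (Y.le_max' y hy).trans_lt hx.1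
    have hcard := Finset.card_pos.2 hYne
    rw [proximityRegion, if_neg fun h => lt_irrefl _ (hlt x h), cellIndex_eq_card_add_one hlt,
      if_neg (by omega), if_pos rfl, orderStat_card δ₁ δ₂ hYne]

/-- The map scales Lebesgue measure by `|α⁻¹|`, which is also the length of `A`, the preimage of
`(0, 1)`. -/
lemma map_restrict_affine {A : Set ℝ} {α β : ℝ} (hα : α ≠ 0)
    (hA : ∀ x, x ∈ A ↔ α * x + β ∈ Set.Ioo (0 : ℝ) 1) :
    (volume.restrict A).map (fun x => α * x + β) = volume A • unitUniform := by
  have hφ : Measurable fun x : ℝ => α * x + β := by fun_prop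
  have hA' : A = (fun x => α * x + β) ⁻¹' Set.Ioo (0 : ℝ) 1 := Set.ext hA
  have hmap : Measure.map (fun x : ℝ => α * x + β) volume = ENNReal.ofReal |α⁻¹| • volume := by
    have : (fun x : ℝ => α * x + β) = (fun x => x + β) ∘ (fun x => α * x) := rfl
    rw [this, ← Measure.map_map (by fun_prop) (by fun_prop), Real.map_volume_mul_left hα,
      Measure.map_smul, (measurePreserving_add_right volume β).map_eq]
  have hvol : volume A = ENNReal.ofReal |α⁻¹| := by
    rw [hA', ← Measure.map_apply hφ measurableSet_Ioo, hmap]; simp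
  rw [hvol, hA', ← Measure.restrict_map hφ measurableSet_Ioo, hmap, Measure.restrict_smul,
    unitUniform]

/-! ### Arc probability and covariance in an end interval -/

section Moments

variable {A : Set ℝ} {N : ℝ → Set ℝ} {τ α β : ℝ}

lemma IsUnitCoordinate.map_cond (h : IsUnitCoordinate A N τ α β) :
    (cond volume A).map (fun x => α * x + β) = unitUniform := by
  have hmap := map_restrict_affine h.ne_zero h.mem_iff
  rw [ProbabilityTheory.cond, Measure.map_smul, hmap, smul_smul]
  have hvol : volume A = ENNReal.ofReal |α⁻¹| := by
    have hA' : A = (fun x => α * x) ⁻¹' Set.Ioo (-β) (1 - β) := by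
      ext x
      rw [h.mem_iff, Set.mem_preimage, Set.mem_Ioo, Set.mem_Ioo]
      constructor <;> rintro ⟨h1, h2⟩ <;> constructor <;> linarith
    rw [hA', Real.volume_preimage_mul_left h.ne_zero]; simp
  rw [ENNReal.inv_mul_cancel, one_smul]
  · rw [hvol]; simpa using h.ne_zero
  · rw [hvol]; simp

lemma IsUnitCoordinate.isProbabilityMeasure_cond (h : IsUnitCoordinate A N τ α β) :
    IsProbabilityMeasure (cond volume A) := by
  refine ⟨?_⟩
  have := congrArg (fun m : Measure ℝ => m Set.univ) h.map_cond
  simpa [Measure.map_apply (show Measurable fun x : ℝ => α * x + β by fun_prop)] using this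

lemma IsUnitCoordinate.measurableSet (h : IsUnitCoordinate A N τ α β) : MeasurableSet A := by
  have hA' : A = (fun x => α * x + β) ⁻¹' Set.Ioo (0 : ℝ) 1 := Set.ext h.mem_iff
  rw [hA']
  exact measurableSet_Ioo.preimage (by fun_prop)

lemma IsUnitCoordinate.indicator_region (h : IsUnitCoordinate A N τ α β) {x z : ℝ} (hx : x ∈ A)
    (hz : z ∈ A) : (N x).indicator (1 : ℝ → ℝ) z = arcInd τ (α * x + β) (α * z + β) := by
  classical
  simp only [Set.indicator_apply, arcInd, h.mem_region_iff x hx z hz, Set.mem_ofPred_eq,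
    Pi.one_apply]

lemma IsUnitCoordinate.arcKernel_eq (h : IsUnitCoordinate A N τ α β) {x z : ℝ} (hx : x ∈ A)
    (hz : z ∈ A) : arcKernel N x z = unitKernel τ (α * x + β) (α * z + β) := by
  rw [arcKernel, unitKernel, h.indicator_region hx hz, h.indicator_region hz hx]

lemma IsUnitCoordinate.arcProb_eq (h : IsUnitCoordinate A N τ α β) (hτ : 0 < τ) :
    ((cond volume A).prod (cond volume A)).real {p | p.2 ∈ N p.1} = endMean τ := by
  have := h.isProbabilityMeasure_cond
  have hφ : Measurable fun x : ℝ => α * x + β := by fun_prop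
  set T : Set (ℝ × ℝ) := {p | (1 - τ) * p.1 < p.2 ∧ p.2 < (1 + τ) * p.1} with hT
  have hTm : MeasurableSet T := by
    rw [hT, Set.ofPred_and]
    exact (measurableSet_lt (by fun_prop) (by fun_prop)).inter
      (measurableSet_lt (by fun_prop) (by fun_prop))
  have hmem : ∀ᵐ x ∂(cond volume A), x ∈ A := ae_cond_mem h.measurableSet
  -- Almost everywhere equality with a measurable preimage suffices, so no measurability of `N` is
  -- needed.
  have hae : ({p | p.2 ∈ N p.1} : Set (ℝ × ℝ)) =ᵐ[(cond volume A).prod (cond volume A)]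
      Prod.map (fun x => α * x + β) (fun x => α * x + β) ⁻¹' T := by
    filter_upwards [Measure.quasiMeasurePreserving_fst.ae hmem,
      Measure.quasiMeasurePreserving_snd.ae hmem] with p h1 h2
    exact propext (h.mem_region_iff _ h1 _ h2)
  rw [measureReal_congr hae, ← map_measureReal_apply (hφ.prodMap hφ) hTm,
    ← Measure.map_prod_map _ _ hφ hφ, h.map_cond, ← integral_indicator_one hTm,
    ← integral_integral_arcInd hτ]
  exact (integral_prod _ (integrable_arcInd τ))

end Moments

lemma covariance_congr {Ω : Type*} [MeasurableSpace Ω] {μ : Measure Ω} {X X' Z Z' : Ω → ℝ}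
    (hX : X =ᵐ[μ] X') (hZ : Z =ᵐ[μ] Z') : cov[X, Z; μ] = cov[X', Z'; μ] := by
  rw [covariance, covariance, integral_congr_ae hX, integral_congr_ae hZ]
  refine integral_congr_ae ?_
  filter_upwards [hX, hZ] with ω h1 h2
  rw [h1, h2]

/-- Given the common first coordinate `x`, the two values are independent with the same mean `∫ y, h
x y ∂Q`, so the expected product is the second moment of that mean. -/
lemma covariance_common_coordinate {S : Type*} [MeasurableSpace S] (Q : Measure S)
    [IsProbabilityMeasure Q] {h : S → S → ℝ} (hh : Measurable (Function.uncurry h)) {C : ℝ}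
    (hC : ∀ x y, |h x y| ≤ C) :
    cov[fun u : S × S × S => h u.1 u.2.1, fun u : S × S × S => h u.1 u.2.2; Q.prod (Q.prod Q)]
      = Var[fun x => ∫ y, h x y ∂Q; Q] := by
  have hf : Measurable fun x => ∫ y, h x y ∂Q := hh.stronglyMeasurable.integral_prod_right.measurable
  have hfC : ∀ x, |∫ y, h x y ∂Q| ≤ C := fun x => by
    simpa using norm_integral_le_of_norm_le_const (μ := Q) (f := h x) (ae_of_all _ (hC x))
  have m1 : Measurable fun u : S × S × S => h u.1 u.2.1 :=
    hh.comp (f := fun u : S × S × S => (u.1, u.2.1)) (by fun_prop)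
  have m2 : Measurable fun u : S × S × S => h u.1 u.2.2 :=
    hh.comp (f := fun u : S × S × S => (u.1, u.2.2)) (by fun_prop)
  have hL1 : MemLp (fun u : S × S × S => h u.1 u.2.1) 2 (Q.prod (Q.prod Q)) :=
    MemLp.of_bound m1.aestronglyMeasurable C (ae_of_all _ fun u => hC _ _)
  have hL2 : MemLp (fun u : S × S × S => h u.1 u.2.2) 2 (Q.prod (Q.prod Q)) :=
    MemLp.of_bound m2.aestronglyMeasurable C (ae_of_all _ fun u => hC _ _)
  have e1 : ∫ u : S × S × S, h u.1 u.2.1 ∂(Q.prod (Q.prod Q)) = ∫ x, ∫ y, h x y ∂Q ∂Q := by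
    rw [integral_prod _ (hL1.integrable one_le_two)]
    exact integral_congr_ae (ae_of_all _ fun x => by simpa using integral_fun_fst (μ := Q) (ν := Q) (h x))
  have e2 : ∫ u : S × S × S, h u.1 u.2.2 ∂(Q.prod (Q.prod Q)) = ∫ x, ∫ y, h x y ∂Q ∂Q := by
    rw [integral_prod _ (hL2.integrable one_le_two)]
    exact integral_congr_ae (ae_of_all _ fun x => by simpa using integral_fun_snd (μ := Q) (ν := Q) (h x))
  rw [covariance_eq_sub hL1 hL2, variance_eq_sub
    (MemLp.of_bound hf.aestronglyMeasurable C (ae_of_all _ hfC)), e1, e2, ← sq]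
  congr 1
  rw [integral_prod _ (hL1.integrable_mul hL2)]
  refine integral_congr_ae (ae_of_all _ fun x => ?_)
  simp only [Pi.mul_apply, Pi.pow_apply]
  rw [integral_prod_mul, sq]

lemma IsUnitCoordinate.arcCov_eq {A : Set ℝ} {N : ℝ → Set ℝ} {τ α β : ℝ}
    (h : IsUnitCoordinate A N τ α β) (hτ : 0 < τ) :
    4 * cov[fun u : ℝ × ℝ × ℝ => arcKernel N u.1 u.2.1, fun u : ℝ × ℝ × ℝ => arcKernel N u.1 u.2.2;
      (cond volume A).prod ((cond volume A).prod (cond volume A))] = endVariance τ := by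
  have := h.isProbabilityMeasure_cond
  have hφ : Measurable fun x : ℝ => α * x + β := by fun_prop
  set φ : ℝ → ℝ := fun x => α * x + β with hφd
  have hmem : ∀ᵐ x ∂(cond volume A), x ∈ A := ae_cond_mem h.measurableSet
  have hmem3 : ∀ᵐ u ∂((cond volume A).prod ((cond volume A).prod (cond volume A))),
      u.1 ∈ A ∧ u.2.1 ∈ A ∧ u.2.2 ∈ A := by
    filter_upwards [Measure.quasiMeasurePreserving_fst.ae hmem,
      Measure.quasiMeasurePreserving_snd.ae (Measure.quasiMeasurePreserving_fst.ae hmem),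
      Measure.quasiMeasurePreserving_snd.ae (Measure.quasiMeasurePreserving_snd.ae hmem)]
      with u h1 h2 h3 using ⟨h1, h2, h3⟩
  have hU := h.map_cond
  have m1 : Measurable fun u : ℝ × ℝ × ℝ => unitKernel τ u.1 u.2.1 :=
    (measurable_unitKernel τ).comp (f := fun u : ℝ × ℝ × ℝ => (u.1, u.2.1)) (by fun_prop)
  have m2 : Measurable fun u : ℝ × ℝ × ℝ => unitKernel τ u.1 u.2.2 :=
    (measurable_unitKernel τ).comp (f := fun u : ℝ × ℝ × ℝ => (u.1, u.2.2)) (by fun_prop)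
  have key := covariance_common_coordinate unitUniform (measurable_unitKernel τ)
    (abs_unitKernel_le τ)
  have hm3 : Measurable (Prod.map φ (Prod.map φ φ)) := hφ.prodMap (hφ.prodMap hφ)
  have hU3 : unitUniform.prod (unitUniform.prod unitUniform) =
      ((cond volume A).prod ((cond volume A).prod (cond volume A))).map
        (Prod.map φ (Prod.map φ φ)) := by
    rw [← Measure.map_prod_map _ _ hφ (hφ.prodMap hφ), ← Measure.map_prod_map _ _ hφ hφ, hU]
  rw [hU3, covariance_map m1.aestronglyMeasurable m2.aestronglyMeasurable hm3.aemeasurable] at key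
  have e1 : (fun u : ℝ × ℝ × ℝ => arcKernel N u.1 u.2.1)
      =ᵐ[(cond volume A).prod ((cond volume A).prod (cond volume A))]
      (fun u : ℝ × ℝ × ℝ => unitKernel τ u.1 u.2.1) ∘ Prod.map φ (Prod.map φ φ) :=
    hmem3.mono fun u hu => h.arcKernel_eq hu.1 hu.2.1
  have e2 : (fun u : ℝ × ℝ × ℝ => arcKernel N u.1 u.2.2)
      =ᵐ[(cond volume A).prod ((cond volume A).prod (cond volume A))]
      (fun u : ℝ × ℝ × ℝ => unitKernel τ u.1 u.2.2) ∘ Prod.map φ (Prod.map φ φ) :=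
    hmem3.mono fun u hu => h.arcKernel_eq hu.1 hu.2.2
  rw [covariance_congr e1 e2, key, ← variance_two_mul_integral_unitKernel hτ, variance_const_mul]
  norm_num

/-! ### Law of the relative density given the points in the interval -/

/-- The normalized relative density of the points `w a`, `a ∈ s`, of the unit interval. -/
noncomputable def unitDensity {ι : Type*} [DecidableEq ι] (τ : ℝ) (s : Finset ι) (w : ι → ℝ) : ℝ :=
  √(s.card : ℝ) * ((∑ p ∈ s.offDiag, unitKernel τ (w p.1) (w p.2)) /
    (s.card * ((s.card : ℝ) - 1)) - endMean τ)

lemma unitDensity_map {ι κ : Type*} [DecidableEq ι] [DecidableEq κ] (τ : ℝ) (s : Finset ι)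
    (e : ι ↪ κ) (w : κ → ℝ) : unitDensity τ (s.map e) w = unitDensity τ s (fun a => w (e a)) := by
  rw [unitDensity, unitDensity, sum_offDiag_eq _ (fun a b => unitKernel τ (w a) (w b)),
    sum_offDiag_eq _ (fun a b => unitKernel τ (w (e a)) (w (e b)))]
  simp only [Finset.sum_map, Finset.card_map]

lemma measurable_unitDensity {ι : Type*} [DecidableEq ι] (τ : ℝ) (s : Finset ι) :
    Measurable fun w : ι → ℝ => unitDensity τ s w := by
  refine ((Finset.measurable_sum _ fun p _ => ?_).div_const _ |>.sub_const _).const_mul _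
  exact (measurable_unitKernel τ).comp (f := fun w : ι → ℝ => (w p.1, w p.2)) (by fun_prop)

/-- The law of the normalized relative density of `k` independent uniform points. -/
noncomputable def unitLaw (τ : ℝ) (k : ℕ) : Measure ℝ :=
  (Measure.infinitePi fun _ : ℕ => unitUniform).map (unitDensity τ (Finset.range k))

instance (τ : ℝ) (k : ℕ) : IsProbabilityMeasure (unitLaw τ k) :=
  Measure.isProbabilityMeasure_map (measurable_unitDensity τ _).aemeasurable

/-- The coordinates are independent and identically distributed, so the labels can be replaced by
`0, ..., k - 1`. -/
lemma map_pi_unitDensity (τ : ℝ) {ι : Type*} [Fintype ι] [DecidableEq ι] {k : ℕ}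
    (hk : Fintype.card ι = k) :
    (Measure.pi fun _ : ι => unitUniform).map (unitDensity τ Finset.univ) = unitLaw τ k := by
  let e : ι ↪ ℕ := (Fintype.equivFinOfCardEq hk).toEmbedding.trans Fin.valEmbedding
  have he : (Finset.univ : Finset ι).map e = Finset.range k := by
    ext j
    simp only [e, Finset.mem_map, Finset.mem_univ, true_and, Finset.mem_range]
    constructor
    · rintro ⟨a, rfl⟩; exact (Fintype.equivFinOfCardEq hk a).2
    · intro hj; exact ⟨(Fintype.equivFinOfCardEq hk).symm ⟨j, hj⟩, by simp⟩
  have hind : iIndepFun (fun (j : ℕ) (w : ℕ → ℝ) => w j)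
      (Measure.infinitePi fun _ : ℕ => unitUniform) :=
    iIndepFun_infinitePi (X := fun _ x => x) fun _ => measurable_id
  have hpi := (hind.precomp e.injective).map_fun_eq_pi_map fun a => (measurable_pi_apply _).aemeasurable
  simp only [Measure.infinitePi_map_eval] at hpi
  rw [← hpi, Measure.map_map (measurable_unitDensity τ _) (by fun_prop), unitLaw]
  congr 1
  ext w
  rw [← he, unitDensity_map]
  rfl

lemma pi_const_smul {ι : Type*} [Fintype ι] (Q : Measure ℝ) [IsFiniteMeasure Q] {p : ENNReal}
    (hp : p ≠ ⊤) :
    (Measure.pi fun _ : ι => p • Q) = p ^ Fintype.card ι • Measure.pi fun _ : ι => Q := by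
  have : IsFiniteMeasure (p • Q) := Q.smul_finite hp
  refine Measure.pi_eq fun s _ => ?_
  simp [Measure.pi_pi, Finset.prod_mul_distrib]

/-- The event that exactly the points with indices in `S` lie in `A`. -/
def pointsInEvent {Ω : Type*} (X : ℕ → Ω → ℝ) (A : Set ℝ) {n : ℕ} (S : Finset (Fin n)) : Set Ω :=
  {ω | ∀ a : Fin n, X a ω ∈ A ↔ a ∈ S}

open scoped Classical in
/-- The indices of the points in `A`. -/
noncomputable def pointsIn (A : Set ℝ) (n : ℕ) (x : ℕ → ℝ) : Finset (Fin n) :=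
  Finset.univ.filter fun a => x a ∈ A

lemma mem_pointsInEvent_iff {Ω : Type*} {X : ℕ → Ω → ℝ} {A : Set ℝ} {n : ℕ} {S : Finset (Fin n)} {ω : Ω} :
    ω ∈ pointsInEvent X A S ↔ pointsIn A n (fun l => X l ω) = S := by
  simp [pointsInEvent, pointsIn, Finset.ext_iff]

section ConditionalLaw

variable {Ω : Type*} [MeasurableSpace Ω] {P : Measure Ω}
  {X : ℕ → Ω → ℝ} {μ₀ : Measure ℝ} [IsProbabilityMeasure μ₀] {A : Set ℝ} {φ : ℝ → ℝ}

lemma measurable_unitDensity_comp (hX : ∀ j, Measurable (X j)) (hφ : Measurable φ) (τ : ℝ) {n : ℕ}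
    (S : Finset (Fin n)) : Measurable fun ω => unitDensity τ S (fun a => φ (X a ω)) :=
  (measurable_unitDensity τ S).comp (g := fun w : Fin n → ℝ => unitDensity τ S w)
    (f := fun ω (a : Fin n) => φ (X a ω)) (measurable_pi_lambda _ fun a => hφ.comp (hX a))

/-- The event factors into a condition on the coordinates in `S` and one on those outside, which are
independent. Restricting the product measure to `A` in every coordinate of `S` gives the product of
the restrictions, and `φ` maps each of these to `μ₀ A` times the uniform law. -/
lemma measure_pointsInEvent_inter (hX : ∀ j, Measurable (X j)) (hind : iIndepFun X P)
    (hlaw : ∀ j, P.map (X j) = μ₀) (hA : MeasurableSet A) (hφ : Measurable φ)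
    (hmap : (μ₀.restrict A).map φ = μ₀ A • unitUniform) (τ : ℝ) {n : ℕ} (S : Finset (Fin n))
    {B : Set ℝ} (hB : MeasurableSet B) :
    P (pointsInEvent X A S ∩ {ω | unitDensity τ S (fun a => φ (X a ω)) ∈ B})
      = μ₀ A ^ S.card * μ₀ Aᶜ ^ (n - S.card) * unitLaw τ S.card B := by
  have hind' : iIndepFun (fun (a : Fin n) => X a) P := hind.precomp Fin.val_injective
  have hpi : ∀ T : Finset (Fin n), P.map (fun ω (a : T) => X a ω) = Measure.pi fun _ : T => μ₀ :=
    fun T => by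
      have := (hind'.precomp (g := ((↑) : T → Fin n)) Subtype.val_injective).map_fun_eq_pi_map
        fun a => (hX _).aemeasurable
      simpa only [hlaw] using this
  have hBm : MeasurableSet (unitDensity τ (Finset.univ : Finset S) ⁻¹' B) :=
    measurable_unitDensity τ _ hB
  have hφS : Measurable fun (x : S → ℝ) a => φ (x a) := by fun_prop
  set D : Set (S → ℝ) := (fun x a => φ (x a)) ⁻¹' (unitDensity τ Finset.univ ⁻¹' B) with hD
  have hDm : MeasurableSet D := hφS hBm
  have hAS : MeasurableSet (Set.univ.pi fun _ : S => A) := .univ_pi fun _ => hA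
  have hAc : MeasurableSet (Set.univ.pi fun _ : (Sᶜ : Finset (Fin n)) => Aᶜ) :=
    .univ_pi fun _ => hA.compl
  have hset : pointsInEvent X A S ∩ {ω | unitDensity τ S (fun a => φ (X a ω)) ∈ B}
      = (fun ω (a : S) => X a ω) ⁻¹' (D ∩ Set.univ.pi fun _ => A) ∩
        (fun ω (a : (Sᶜ : Finset (Fin n))) => X a ω) ⁻¹' (Set.univ.pi fun _ => Aᶜ) := by
    ext ω
    have hu : unitDensity τ S (fun a => φ (X a ω))
        = unitDensity τ (Finset.univ : Finset S) (fun a => φ (X a ω)) := by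
      conv_lhs => rw [← Finset.attach_map_val (s := S), unitDensity_map]
      rfl
    simp only [pointsInEvent, Set.mem_inter_iff, Set.mem_ofPred_eq, Set.mem_preimage, hD, hu,
      Set.mem_pi, Set.mem_univ, forall_const, Set.mem_compl_iff, Subtype.forall,
      Finset.mem_compl]
    constructor
    · rintro ⟨h1, h2⟩
      exact ⟨⟨h2, fun a ha => (h1 a).2 ha⟩, fun a ha h => ha ((h1 a).1 h)⟩
    · rintro ⟨⟨h1, h2⟩, h3⟩
      exact ⟨fun a => ⟨fun h => by_contra fun ha => h3 a ha h, h2 a⟩, h1⟩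
  have hmS : Measurable fun ω (a : S) => X a ω := by fun_prop
  have hmC : Measurable fun ω (a : (Sᶜ : Finset (Fin n))) => X a ω := by fun_prop
  have hi : IndepFun (fun ω (a : S) => X a ω) (fun ω (a : (Sᶜ : Finset (Fin n))) => X a ω) P :=
    hind'.indepFun_finset S Sᶜ disjoint_compl_right fun a => hX a
  rw [hset, hi.measure_inter_preimage_eq_mul _ _ (hDm.inter hAS) hAc,
    ← Measure.map_apply hmS (hDm.inter hAS), ← Measure.map_apply hmC hAc, hpi, hpi,
    Measure.pi_pi, ← Measure.restrict_apply hDm, Measure.restrict_pi_pi]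
  rw [hD, ← Measure.map_apply hφS hBm, Measure.pi_map_pi fun _ => hφ.aemeasurable]
  simp only [hmap]
  rw [pi_const_smul _ (measure_ne_top _ _), Measure.smul_apply,
    ← Measure.map_apply (measurable_unitDensity τ _) hB,
    map_pi_unitDensity τ (Fintype.card_coe S)]
  simp only [smul_eq_mul, Fintype.card_coe, Finset.prod_const, Finset.card_univ,
    Finset.card_compl, Fintype.card_fin]
  ring

lemma measurableSet_pointsInEvent (hX : ∀ j, Measurable (X j)) (hA : MeasurableSet A) {n : ℕ}
    (S : Finset (Fin n)) : MeasurableSet (pointsInEvent X A S) := by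
  have : pointsInEvent X A S = ⋂ a : Fin n, X a ⁻¹' (if a ∈ S then A else Aᶜ) := by
    ext ω
    simp only [pointsInEvent, Set.mem_ofPred_eq, Set.mem_iInter, Set.mem_preimage]
    refine forall_congr' fun a => ?_
    split_ifs with h <;> simp [h]
  rw [this]
  exact MeasurableSet.iInter fun a => (hX a) (by split_ifs; exacts [hA, hA.compl])

lemma measurable_pointsIn (hX : ∀ j, Measurable (X j)) (hA : MeasurableSet A) (n : ℕ) :
    Measurable[_, ⊤] fun ω => pointsIn A n (fun l => X l ω) := by
  refine @measurable_to_countable' _ _ ⊤ _ _ _ fun S => ?_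
  have : (fun ω => pointsIn A n (fun l => X l ω)) ⁻¹' {S} = pointsInEvent X A S := by
    ext ω; rw [mem_pointsInEvent_iff]; rfl
  rw [this]
  exact measurableSet_pointsInEvent hX hA S

/-- Joint law of the number of points in `A` and their normalized relative density. -/
lemma measure_card_pointsIn_inter (hX : ∀ j, Measurable (X j)) (hind : iIndepFun X P)
    (hlaw : ∀ j, P.map (X j) = μ₀) (hA : MeasurableSet A) (hφ : Measurable φ)
    (hmap : (μ₀.restrict A).map φ = μ₀ A • unitUniform) (τ : ℝ) (n k : ℕ)
    {B : Set ℝ} (hB : MeasurableSet B) :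
    P ({ω | (pointsIn A n fun l => X l ω).card = k} ∩
        {ω | unitDensity τ (pointsIn A n fun l => X l ω) (fun a => φ (X a ω)) ∈ B})
      = n.choose k * (μ₀ A ^ k * μ₀ Aᶜ ^ (n - k)) * unitLaw τ k B := by
  -- Disjoint decomposition by the index set of the points in `A`; all sets of size `k` have the
  -- same probability, whence the binomial coefficient.
  have hset : {ω | (pointsIn A n fun l => X l ω).card = k} ∩
        {ω | unitDensity τ (pointsIn A n fun l => X l ω) (fun a => φ (X a ω)) ∈ B}
      = ⋃ S ∈ (Finset.univ : Finset (Fin n)).powersetCard k,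
        (pointsInEvent X A S ∩ {ω | unitDensity τ S (fun a => φ (X a ω)) ∈ B}) := by
    ext ω
    simp only [Set.mem_inter_iff, Set.mem_ofPred_eq, Set.mem_iUnion, Finset.mem_powersetCard_univ,
      mem_pointsInEvent_iff, exists_prop]
    constructor
    · rintro ⟨h1, h2⟩; exact ⟨_, h1, rfl, h2⟩
    · rintro ⟨S, h1, rfl, h2⟩; exact ⟨h1, h2⟩
  rw [hset, measure_biUnion_finset]
  · rw [Finset.sum_congr rfl fun S hS => by
      rw [measure_pointsInEvent_inter hX hind hlaw hA hφ hmap τ S hB,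
        (Finset.mem_powersetCard.1 hS).2]]
    rw [Finset.sum_const, Finset.card_powersetCard, Finset.card_univ, Fintype.card_fin,
      nsmul_eq_mul, ← mul_assoc]
  · intro S _ T _ hST
    refine Set.disjoint_left.2 fun ω h1 h2 => hST ?_
    rw [← mem_pointsInEvent_iff.1 h1.1, ← mem_pointsInEvent_iff.1 h2.1]
  · intro S _
    exact (measurableSet_pointsInEvent hX hA S).inter
      (measurable_unitDensity_comp hX hφ τ S hB)

lemma measure_card_pointsIn (hX : ∀ j, Measurable (X j)) (hind : iIndepFun X P)
    (hlaw : ∀ j, P.map (X j) = μ₀) (hA : MeasurableSet A) (hφ : Measurable φ)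
    (hmap : (μ₀.restrict A).map φ = μ₀ A • unitUniform) (n k : ℕ) :
    P {ω | (pointsIn A n fun l => X l ω).card = k}
      = n.choose k * (μ₀ A ^ k * μ₀ Aᶜ ^ (n - k)) := by
  -- With `B = univ` the density is unconstrained, so the value `1` for `τ` is arbitrary.
  simpa using measure_card_pointsIn_inter hX hind hlaw hA hφ hmap 1 n k MeasurableSet.univ

lemma measurable_unitDensity_pointsIn (hX : ∀ j, Measurable (X j)) (hA : MeasurableSet A)
    (hφ : Measurable φ) (τ : ℝ) (n : ℕ) :
    Measurable fun ω => unitDensity τ (pointsIn A n fun l => X l ω) (fun a => φ (X a ω)) := by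
  intro B hB
  have : (fun ω => unitDensity τ (pointsIn A n fun l => X l ω) (fun a => φ (X a ω))) ⁻¹' B
      = ⋃ S : Finset (Fin n),
        (pointsInEvent X A S ∩ {ω | unitDensity τ S (fun a => φ (X a ω)) ∈ B}) := by
    ext ω
    simp [mem_pointsInEvent_iff]
  rw [this]
  exact MeasurableSet.iUnion fun S => (measurableSet_pointsInEvent hX hA S).inter
    (measurable_unitDensity_comp hX hφ τ S hB)

lemma measurableSet_card_pointsIn (hX : ∀ j, Measurable (X j)) (hA : MeasurableSet A) (n k : ℕ) :
    MeasurableSet {ω | (pointsIn A n fun l => X l ω).card = k} :=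
  measurable_pointsIn hX hA n (t := {S | S.card = k}) trivial

/-- Law of the normalized relative density on the event that `k` points lie in `A`. -/
lemma map_restrict_card_pointsIn (hX : ∀ j, Measurable (X j)) (hind : iIndepFun X P)
    (hlaw : ∀ j, P.map (X j) = μ₀) (hA : MeasurableSet A) (hφ : Measurable φ)
    (hmap : (μ₀.restrict A).map φ = μ₀ A • unitUniform) (τ : ℝ) (n k : ℕ) :
    (P.restrict {ω | (pointsIn A n fun l => X l ω).card = k}).map
        (fun ω => unitDensity τ (pointsIn A n fun l => X l ω) (fun a => φ (X a ω)))
      = P {ω | (pointsIn A n fun l => X l ω).card = k} • unitLaw τ k := by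
  have hm := measurable_unitDensity_pointsIn hX hA hφ τ n
  ext B hB
  rw [Measure.map_apply hm hB, Measure.restrict_apply (hB.preimage hm), Set.inter_comm,
    Measure.smul_apply, smul_eq_mul, measure_card_pointsIn hX hind hlaw hA hφ hmap]
  exact measure_card_pointsIn_inter hX hind hlaw hA hφ hmap τ n k hB

end ConditionalLaw

/-! ### Limit theorems for a prescribed and for a random number of points -/

/-- The normalized relative density of independent uniform points is asymptotically normal. -/
lemma tendsto_unitLaw {τ : ℝ} (hτ : 0 < τ) :
    Tendsto (β := ProbabilityMeasure ℝ) (fun k => ⟨unitLaw τ k, inferInstance⟩) atTop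
      (𝓝 ⟨gaussianReal 0 (endVariance τ).toNNReal, inferInstance⟩) := by
  have hind : iIndepFun (fun (j : ℕ) (w : ℕ → ℝ) => w j)
      (Measure.infinitePi fun _ : ℕ => unitUniform) :=
    iIndepFun_infinitePi (X := fun _ x => x) fun _ => measurable_id
  have h := (tendstoInDistribution_uStatistic (Q := unitUniform)
    (fun j => measurable_pi_apply j) (fun j => Measure.infinitePi_map_eval _ j) hind
    (measurable_unitKernel τ) (abs_unitKernel_le τ) (unitKernel_symm τ)).tendsto
  refine (h.congr fun k => Subtype.ext ?_).mono_right (le_of_eq (congrArg 𝓝 (Subtype.ext ?_)))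
  · simp only [unitLaw, integral_integral_unitKernel hτ]
    congr 1
    ext w
    simp [unitDensity]
  · simp [variance_two_mul_integral_unitKernel hτ]

lemma tendsto_card_pointsIn {A : Set ℝ} {x : ℕ → ℝ} (h : ∃ᶠ j in atTop, x j ∈ A) :
    Tendsto (fun n => (pointsIn A n x).card) atTop atTop := by
  classical
  have hc : ∀ n, (pointsIn A n x).card = Nat.count (fun j => x j ∈ A) n := fun n => by
    rw [Nat.count_eq_card_filter_range, ← Finset.card_map Fin.valEmbedding]
    congr 1
    ext j
    simp only [pointsIn, Finset.mem_map, Finset.mem_filter, Finset.mem_univ, true_and,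
      Finset.mem_range, Fin.valEmbedding_apply]
    constructor
    · rintro ⟨a, ha, rfl⟩; exact ⟨a.2, ha⟩
    · rintro ⟨hj, hx⟩; exact ⟨⟨j, hj⟩, hx, rfl⟩
  have hinf := Nat.frequently_atTop_iff_infinite.1 h
  -- Visits to `A` are numbered from zero, so exactly `K` of them precede the time `Nat.nth _ K`.
  refine tendsto_atTop_atTop.2 fun K => ⟨Nat.nth (fun j => x j ∈ A) K, fun n hn => ?_⟩
  calc K = Nat.count (fun j => x j ∈ A) (Nat.nth (fun j => x j ∈ A) K) :=
        (Nat.count_nth_of_infinite hinf K).symm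
    _ ≤ Nat.count (fun j => x j ∈ A) n := Nat.count_monotone _ hn
    _ = _ := (hc n).symm

section Convergence

variable {Ω : Type*} [MeasurableSpace Ω] {P : Measure Ω} [IsProbabilityMeasure P]
  {X : ℕ → Ω → ℝ} {μ₀ : Measure ℝ} {A : Set ℝ}

/-- Second Borel–Cantelli lemma: the events `X j ∈ A` are independent with a common positive
probability, so almost surely infinitely many occur. -/
lemma ae_tendsto_card_pointsIn (hX : ∀ j, Measurable (X j)) (hind : iIndepFun X P)
    (hlaw : ∀ j, P.map (X j) = μ₀) (hA : MeasurableSet A) (hA0 : μ₀ A ≠ 0) :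
    ∀ᵐ ω ∂P, Tendsto (fun n => (pointsIn A n fun l => X l ω).card) atTop atTop := by
  have hm : ∀ j, MeasurableSet (X j ⁻¹' A) := fun j => hX j hA
  have hs : iIndepSet (fun j => X j ⁻¹' A) P := (iIndepSet_iff_meas_biInter hm).2 fun S =>
    iIndepFun_iff_measure_inter_preimage_eq_mul.1 hind S (sets := fun _ => A) fun _ _ => hA
  have hP : ∀ j, P (X j ⁻¹' A) = μ₀ A := fun j => by rw [← hlaw j, Measure.map_apply (hX j) hA]
  have h1 := measure_limsup_eq_one hm hs
    (by simp only [hP]; exact ENNReal.tsum_const_eq_top_of_ne_zero hA0)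
  have h2 := (mem_ae_iff_prob_eq_one (MeasurableSet.measurableSet_limsup hm)).2 h1
  filter_upwards [h2] with ω hω
  exact tendsto_card_pointsIn (mem_limsup_iff_frequently_mem.1 hω)

variable [IsProbabilityMeasure μ₀] {φ : ℝ → ℝ} {τ : ℝ}

/-- Asymptotic normality given the number of points in `A`. -/
lemma tendstoInDistribution_cond (hX : ∀ j, Measurable (X j)) (hind : iIndepFun X P)
    (hlaw : ∀ j, P.map (X j) = μ₀) (hA : MeasurableSet A) (hA0 : μ₀ A ≠ 0) (hA1 : μ₀ Aᶜ ≠ 0)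
    (hφ : Measurable φ) (hmap : (μ₀.restrict A).map φ = μ₀ A • unitUniform) (hτ : 0 < τ)
    {n k : ℕ → ℕ} (hkn : ∀ j, k j ≤ n j) (hk : Tendsto k atTop atTop) :
    ∃ _ : ∀ j, IsProbabilityMeasure (P[|{ω | (pointsIn A (n j) fun l => X l ω).card = k j}]),
      TendstoInDistribution
        (fun j ω => unitDensity τ (pointsIn A (n j) fun l => X l ω) (fun a => φ (X a ω)))
        atTop (id : ℝ → ℝ) (fun j => P[|{ω | (pointsIn A (n j) fun l => X l ω).card = k j}])
        (gaussianReal 0 (endVariance τ).toNNReal) := by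
  have hpos : ∀ j, P {ω | (pointsIn A (n j) fun l => X l ω).card = k j} ≠ 0 := fun j => by
    rw [measure_card_pointsIn hX hind hlaw hA hφ hmap]
    exact mul_ne_zero (by exact_mod_cast (Nat.choose_pos (hkn j)).ne')
      (mul_ne_zero (pow_ne_zero _ hA0) (pow_ne_zero _ hA1))
  have hprob : ∀ j, IsProbabilityMeasure
      (P[|{ω | (pointsIn A (n j) fun l => X l ω).card = k j}]) := fun j =>
    cond_isProbabilityMeasure (hpos j)
  refine ⟨hprob, fun j => (measurable_unitDensity_pointsIn hX hA hφ τ _).aemeasurable,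
    aemeasurable_id, ?_⟩
  -- The conditional law is exactly `unitLaw τ (k j)`, so only `k j → ∞` matters and `n j` plays no
  -- role in the limit.
  refine (((tendsto_unitLaw hτ).comp hk).congr fun j => Subtype.ext ?_).mono_right
    (le_of_eq (congrArg 𝓝 (Subtype.ext ?_)))
  · simp only [ProbabilityTheory.cond, Measure.map_smul]
    rw [map_restrict_card_pointsIn hX hind hlaw hA hφ hmap, smul_smul,
      ENNReal.inv_mul_cancel (hpos j) (measure_ne_top _ _), one_smul]
    rfl
  · simp

/-- Law of total expectation over the number of points in `A`: on the event that it equals `k`, the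
density has law `unitLaw τ k`. -/
lemma integral_unitDensity_pointsIn (hX : ∀ j, Measurable (X j)) (hind : iIndepFun X P)
    (hlaw : ∀ j, P.map (X j) = μ₀) (hA : MeasurableSet A) (hφ : Measurable φ)
    (hmap : (μ₀.restrict A).map φ = μ₀ A • unitUniform) (n : ℕ)
    (f : BoundedContinuousFunction ℝ ℝ) :
    ∫ ω, f (unitDensity τ (pointsIn A n fun l => X l ω) (fun a => φ (X a ω))) ∂P
      = ∫ ω, (∫ z, f z ∂(unitLaw τ (pointsIn A n fun l => X l ω).card)) ∂P := by
  have hm := measurable_unitDensity_pointsIn hX hA hφ τ n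
  set E : ℕ → Set Ω := fun k => {ω | (pointsIn A n fun l => X l ω).card = k} with hE
  have hEm : ∀ k, MeasurableSet (E k) := measurableSet_card_pointsIn hX hA n
  have hEd : Pairwise (Function.onFun Disjoint E) := fun a b hab =>
    Set.disjoint_left.2 fun ω h1 h2 => hab (h1.symm.trans h2)
  have hEu : ⋃ k, E k = Set.univ := by
    ext ω; simp [hE]
  have hcard : Measurable fun ω => (pointsIn A n fun l => X l ω).card :=
    measurable_to_countable' fun k => hEm k
  have hb : ∀ k, ‖∫ z, f z ∂(unitLaw τ k)‖ ≤ ‖f‖ := fun k =>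
    f.norm_integral_le_norm (unitLaw τ k)
  have i1 : Integrable (fun ω =>
      f (unitDensity τ (pointsIn A n fun l => X l ω) (fun a => φ (X a ω)))) P :=
    Integrable.of_bound (f.continuous.measurable.comp hm).aestronglyMeasurable ‖f‖
      (ae_of_all _ fun ω => f.norm_coe_le_norm _)
  have i2 : Integrable (fun ω => ∫ z, f z ∂(unitLaw τ (pointsIn A n fun l => X l ω).card)) P :=
    Integrable.of_bound ((measurable_from_nat (f := fun k => ∫ z, f z ∂(unitLaw τ k))).comp
      hcard).aestronglyMeasurable ‖f‖ (ae_of_all _ fun ω => hb _)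
  rw [← setIntegral_univ (μ := P), ← hEu, integral_iUnion hEm hEd i1.integrableOn,
    ← setIntegral_univ (μ := P), ← hEu, integral_iUnion hEm hEd i2.integrableOn]
  refine tsum_congr fun k => ?_
  have e2 : ∫ ω in E k, (∫ z, f z ∂(unitLaw τ (pointsIn A n fun l => X l ω).card)) ∂P
      = ∫ ω in E k, (∫ z, f z ∂(unitLaw τ k)) ∂P :=
    setIntegral_congr_fun (hEm k) fun ω hω => by
      have h : (pointsIn A n fun l => X l ω).card = k := hω
      simp only [h]
  rw [e2, setIntegral_const, ← integral_map (φ := fun ω =>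
    unitDensity τ (pointsIn A n fun l => X l ω) (fun a => φ (X a ω))) hm.aemeasurable
    f.continuous.aestronglyMeasurable, map_restrict_card_pointsIn hX hind hlaw hA hφ hmap,
    integral_smul_measure]
  rfl

/-- Asymptotic normality with a random number of points in `A`. -/
lemma tendstoInDistribution_unitDensity (hX : ∀ j, Measurable (X j)) (hind : iIndepFun X P)
    (hlaw : ∀ j, P.map (X j) = μ₀) (hA : MeasurableSet A) (hA0 : μ₀ A ≠ 0)
    (hφ : Measurable φ) (hmap : (μ₀.restrict A).map φ = μ₀ A • unitUniform) (hτ : 0 < τ) :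
    TendstoInDistribution
      (fun n ω => unitDensity τ (pointsIn A n fun l => X l ω) (fun a => φ (X a ω)))
      atTop (id : ℝ → ℝ) (fun _ => P) (gaussianReal 0 (endVariance τ).toNNReal) := by
  have hm := measurable_unitDensity_pointsIn hX hA hφ τ
  refine ⟨fun n => (hm n).aemeasurable, aemeasurable_id, ?_⟩
  refine ProbabilityMeasure.tendsto_iff_forall_integral_tendsto.2 fun f => ?_
  have hL := (ProbabilityMeasure.tendsto_iff_forall_integral_tendsto.1 (tendsto_unitLaw hτ)) f
  simp only [ProbabilityMeasure.coe_mk, Measure.map_id] at hL ⊢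
  have e : ∀ n, ∫ z, f z ∂(P.map fun ω =>
      unitDensity τ (pointsIn A n fun l => X l ω) (fun a => φ (X a ω)))
      = ∫ ω, (∫ z, f z ∂(unitLaw τ (pointsIn A n fun l => X l ω).card)) ∂P := fun n => by
    rw [integral_map (hm n).aemeasurable f.continuous.aestronglyMeasurable,
      integral_unitDensity_pointsIn hX hind hlaw hA hφ hmap]
  simp only [e]
  have hconst : ∫ z, f z ∂(gaussianReal 0 (endVariance τ).toNNReal)
      = ∫ _ω, (∫ z, f z ∂(gaussianReal 0 (endVariance τ).toNNReal)) ∂P := by simp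
  rw [hconst]
  -- The inner integral is a deterministic sequence, bounded by `‖f‖` and convergent, evaluated at a
  -- random index that tends to infinity almost surely.
  refine tendsto_integral_of_dominated_convergence (fun _ => ‖f‖) (fun n => ?_)
    (integrable_const _) (fun n => ae_of_all _ fun ω => f.norm_integral_le_norm _) ?_
  · have hcard : Measurable fun ω => (pointsIn A n fun l => X l ω).card :=
      measurable_to_countable' fun k => measurableSet_card_pointsIn hX hA n k
    exact ((measurable_from_nat (f := fun k => ∫ z, f z ∂(unitLaw τ k))).comp
      hcard).aestronglyMeasurable
  · filter_upwards [ae_tendsto_card_pointsIn hX hind hlaw hA hA0] with ω hω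
    exact hL.comp hω

end Convergence

/-! ### From the digraph to the `U`-statistic -/

lemma coe_pointsIn (δ₁ δ₂ : ℝ) (Y : Finset ℝ) (i n : ℕ) (x : ℕ → ℝ) :
    (pointsIn (cell δ₁ δ₂ Y i) n x : Set (Fin n)) = cellVertices δ₁ δ₂ Y i n x := by
  ext a; simp [pointsIn, cellVertices]

lemma cellCount_eq (δ₁ δ₂ : ℝ) (Y : Finset ℝ) (i n : ℕ) (x : ℕ → ℝ) :
    cellCount δ₁ δ₂ Y i n x = (pointsIn (cell δ₁ δ₂ Y i) n x).card := by
  rw [cellCount, ← coe_pointsIn]; simp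

/-- Swapping the two entries permutes the ordered pairs, so symmetrizing the kernel leaves the
number of arcs unchanged. -/
lemma sum_unitKernel (τ : ℝ) {ι : Type*} [DecidableEq ι] (s : Finset ι) (w : ι → ℝ) :
    ∑ p ∈ s.offDiag, unitKernel τ (w p.1) (w p.2) = ∑ p ∈ s.offDiag, arcInd τ (w p.1) (w p.2) := by
  rw [sum_offDiag_eq _ (fun a b => unitKernel τ (w a) (w b)),
    sum_offDiag_eq _ (fun a b => arcInd τ (w a) (w b))]
  have h : ∑ a ∈ s, ∑ b ∈ s, arcInd τ (w b) (w a) = ∑ a ∈ s, ∑ b ∈ s, arcInd τ (w a) (w b) :=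
    Finset.sum_comm
  simp only [unitKernel, ← Finset.sum_div, Finset.sum_add_distrib, h]
  ring

/-- Only arcs between points of the cell are counted, and for these `arcInd` is the arc indicator.
Both sides have the same denominator, so `n_i ≤ 1` needs no separate treatment. -/
lemma IsUnitCoordinate.normalizedDensity_eq {δ₁ δ₂ : ℝ} {Y : Finset ℝ} {τ c α β : ℝ} {i : ℕ}
    (h : IsUnitCoordinate (cell δ₁ δ₂ Y i) (proximityRegion δ₁ δ₂ Y τ c) τ α β) (n : ℕ)
    (x : ℕ → ℝ) :
    normalizedDensity δ₁ δ₂ Y τ c i n x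
      = unitDensity τ (pointsIn (cell δ₁ δ₂ Y i) n x) (fun a => α * x a + β) := by
  classical
  set S := pointsIn (cell δ₁ δ₂ Y i) n x
  set N := proximityRegion δ₁ δ₂ Y τ c
  have hmem : ∀ a : Fin n, a ∈ S ↔ a ∈ cellVertices δ₁ δ₂ Y i n x := fun a => by
    rw [← coe_pointsIn, Finset.mem_coe]
  have hcell : ∀ a : Fin n, a ∈ S → x a ∈ cell δ₁ δ₂ Y i := fun a ha => (hmem a).1 ha
  have hcount : Nat.card (cellVertices δ₁ δ₂ Y i n x) = S.card := cellCount_eq δ₁ δ₂ Y i n x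
  let e : {p : cellVertices δ₁ δ₂ Y i n x × cellVertices δ₁ δ₂ Y i n x //
      p.1 ≠ p.2 ∧ (cellDigraph δ₁ δ₂ Y τ c i n x).Adj p.1 p.2} ≃
      {p : Fin n × Fin n // p ∈ S.offDiag.filter fun p => x p.2 ∈ N (x p.1)} :=
    { toFun := fun q => ⟨(q.1.1.1, q.1.2.1), by
        simp only [Finset.mem_filter, Finset.mem_offDiag, hmem]
        exact ⟨⟨q.1.1.2, q.1.2.2, fun h => q.2.1 (Subtype.ext h)⟩, q.2.2⟩⟩
      invFun := fun q =>
        have hq := Finset.mem_filter.1 q.2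
        have hq' := Finset.mem_offDiag.1 hq.1
        ⟨(⟨q.1.1, (hmem _).1 hq'.1⟩, ⟨q.1.2, (hmem _).1 hq'.2.1⟩),
          fun h => hq'.2.2 (congrArg Subtype.val h), hq.2⟩
      left_inv := fun _ => rfl
      right_inv := fun _ => rfl }
  have harcs : (Nat.card {p : cellVertices δ₁ δ₂ Y i n x × cellVertices δ₁ δ₂ Y i n x //
      p.1 ≠ p.2 ∧ (cellDigraph δ₁ δ₂ Y τ c i n x).Adj p.1 p.2} : ℝ)
      = ∑ p ∈ S.offDiag, arcInd τ (α * x p.1 + β) (α * x p.2 + β) := by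
    rw [Nat.card_congr e, Nat.card_eq_fintype_card, Fintype.card_coe, Finset.card_filter,
      Nat.cast_sum]
    refine Finset.sum_congr rfl fun p hp => ?_
    rw [Finset.mem_offDiag] at hp
    rw [← h.indicator_region (hcell _ hp.1) (hcell _ hp.2.1), Set.indicator_apply]
    simp
  rw [normalizedDensity, cellDensity, relativeDensity, harcs, hcount, cellCount_eq, unitDensity,
    sum_unitKernel τ S fun a => α * x a + β]

lemma map_restrict_cond {δ₁ δ₂ : ℝ} {A : Set ℝ} {N : ℝ → Set ℝ} {τ α β : ℝ}
    (h : IsUnitCoordinate A N τ α β) (hA : A ⊆ Set.Ioo δ₁ δ₂) :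
    ((ProbabilityTheory.cond volume (Set.Ioo δ₁ δ₂)).restrict A).map (fun x => α * x + β)
      = ProbabilityTheory.cond volume (Set.Ioo δ₁ δ₂) A • unitUniform := by
  rw [cond_apply measurableSet_Ioo, Set.inter_eq_self_of_subset_right hA, ProbabilityTheory.cond,
    Measure.restrict_smul, Measure.restrict_restrict h.measurableSet,
    Set.inter_eq_self_of_subset_left hA, Measure.map_smul,
    map_restrict_affine h.ne_zero h.mem_iff, smul_smul]

end CentralSimilarity

theorem mainTheorem2 {Ω : Type*} [MeasurableSpace Ω] (P : Measure Ω) [IsProbabilityMeasure P]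
    (δ₁ δ₂ : ℝ) (hδ : δ₁ < δ₂)
    (Y : Finset ℝ) (hYne : Y.Nonempty) (hY : ∀ y ∈ Y, y ∈ Set.Ioo δ₁ δ₂)
    (X : ℕ → Ω → ℝ) (hXmeas : ∀ j, Measurable (X j)) (hXindep : iIndepFun X P)
    (hXunif : ∀ j, pdf.IsUniform (X j) (Set.Ioo δ₁ δ₂) P)
    (τ c : ℝ) (hτ : 0 < τ) (hc : c ∈ Set.Ioo (0 : ℝ) 1)
    (i : ℕ) (hi : i = 1 ∨ i = Y.card + 1) :
    -- the arc probability and the covariance of the kernel in an end interval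
    CentralSimilarity.arcProb δ₁ δ₂ Y τ c i = CentralSimilarity.endMean τ ∧
    4 * CentralSimilarity.arcCov δ₁ δ₂ Y τ c i = CentralSimilarity.endVariance τ ∧
    0 < CentralSimilarity.endVariance τ ∧
    -- convergence in law, conditionally on the number of points in the interval, as that number
    -- tends to infinity, along any choice of total sample sizes
    (∀ n k : ℕ → ℕ, (∀ j, k j ≤ n j) → Tendsto k atTop atTop →
      ∃ _ : ∀ j, IsProbabilityMeasure
          (P[|{ω | CentralSimilarity.cellCount δ₁ δ₂ Y i (n j) (fun l => X l ω) = k j}]),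
        TendstoInDistribution
          (fun j ω => CentralSimilarity.normalizedDensity δ₁ δ₂ Y τ c i (n j) (fun l => X l ω))
          atTop (id : ℝ → ℝ)
          (fun j => P[|{ω | CentralSimilarity.cellCount δ₁ δ₂ Y i (n j) (fun l => X l ω) = k j}])
          (gaussianReal 0 (CentralSimilarity.endVariance τ).toNNReal)) ∧
    -- unconditional convergence in law, as the total sample size tends to infinity
    TendstoInDistribution
      (fun n ω => CentralSimilarity.normalizedDensity δ₁ δ₂ Y τ c i n (fun l => X l ω))
      atTop (id : ℝ → ℝ) (fun _ => P)
      (gaussianReal 0 (CentralSimilarity.endVariance τ).toNNReal) := by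
  obtain ⟨l, r, α, β, hl, hlr, hr, hlt, hcell, hcoord⟩ :=
    CentralSimilarity.exists_unitCoordinate hYne hY τ c hi
  have hlaw : ∀ j, P.map (X j) = ProbabilityTheory.cond volume (Set.Ioo δ₁ δ₂) := hXunif
  have hvol : volume (Set.Ioo δ₁ δ₂) ≠ 0 := by simpa using hδ
  have hμ₀ : IsProbabilityMeasure (ProbabilityTheory.cond volume (Set.Ioo δ₁ δ₂)) :=
    cond_isProbabilityMeasure_of_finite hvol (by simp)
  have hsub : CentralSimilarity.cell δ₁ δ₂ Y i ⊆ Set.Ioo δ₁ δ₂ := by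
    rw [hcell]; exact Set.Ioo_subset_Ioo hl hr
  have hA := hcoord.measurableSet
  have hval : ProbabilityTheory.cond volume (Set.Ioo δ₁ δ₂) (CentralSimilarity.cell δ₁ δ₂ Y i)
      = (ENNReal.ofReal (δ₂ - δ₁))⁻¹ * ENNReal.ofReal (r - l) := by
    rw [cond_apply measurableSet_Ioo, Set.inter_eq_self_of_subset_right hsub, hcell,
      Real.volume_Ioo, Real.volume_Ioo]
  have hA0 : ProbabilityTheory.cond volume (Set.Ioo δ₁ δ₂)
      (CentralSimilarity.cell δ₁ δ₂ Y i) ≠ 0 := by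
    rw [hval]
    exact mul_ne_zero (ENNReal.inv_ne_zero.2 ENNReal.ofReal_ne_top)
      (ENNReal.ofReal_pos.2 (sub_pos.2 hlr)).ne'
  -- An end interval is strictly shorter than `(δ₁, δ₂)`. The complement is therefore charged, which
  -- gives the event `n_i = k` positive probability for `k < n` too.
  have hA1 : ProbabilityTheory.cond volume (Set.Ioo δ₁ δ₂)
      (CentralSimilarity.cell δ₁ δ₂ Y i)ᶜ ≠ 0 := by
    rw [Ne, prob_compl_eq_zero_iff hA, hval, mul_comm, ← div_eq_mul_inv]
    refine ne_of_lt (ENNReal.div_lt_of_lt_mul ?_)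
    rw [one_mul]
    exact (ENNReal.ofReal_lt_ofReal_iff (sub_pos.2 hδ)).2 hlt
  have hφ : Measurable fun x : ℝ => α * x + β := by fun_prop
  have hmap := CentralSimilarity.map_restrict_cond hcoord hsub
  simp only [hcoord.normalizedDensity_eq, CentralSimilarity.cellCount_eq]
  refine ⟨hcoord.arcProb_eq hτ, hcoord.arcCov_eq hτ, CentralSimilarity.endVariance_pos hτ,
    fun n k hkn hk => ?_, ?_⟩
  · exact CentralSimilarity.tendstoInDistribution_cond (φ := fun x => α * x + β) hXmeas hXindep hlaw hA hA0 hA1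
      hφ hmap hτ hkn hk
  · exact CentralSimilarity.tendstoInDistribution_unitDensity (φ := fun x => α * x + β) hXmeas hXindep
      hlaw hA hA0 hφ hmap hτ
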